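/- Let $m\ge 2$ and let $p$ be a real number with $p\notin\{0,1,\dots,m+1\}$. Let $D\subset\mathbb R^{2m}$ be a nonempty connected open set with coordinates $(\xi_1,\dots,\xi_m,t_1,\dots,t_m)$. Write $\sigma_k$ for the $k$-th elementary symmetric function of $\xi_1,\dots,\xi_m$, $\sigma_k(\hat\xi_j)$ for that of the $\xi_i$ with $i\ne j$, and $\Delta_j=\prod_{k\ne j}(\xi_j-\xi_k)$. Let $\Theta_1,\dots,\Theta_m$ be smooth real functions of one variable, $\Theta_j$ being defined on the interval $I_j=\xi_j(D)$, and suppose that on $D$ the $\xi_j$ are pairwise distinct, $\Theta_j(\xi_j)/\Delta_j>0$ for every $j$, and $\sigma_m=\prod_j\xi_j$ has no zero. Consider on $D$ the orthotoric Kähler metric $$g=\sum_{j=1}^m\frac{\Delta_j}{\Theta_j(\xi_j)}\,d\xi_j^2+\sum_{j=1}^m\frac{\Theta_j(\xi_j)}{\Delta_j}\Big(\sum_{r=1}^m\sigma_{r-1}(\hat\xi_j)\,dt_r\Big)^2,\qquad \omega=\sum_{j=1}^m d\xi_j\wedge\Big(\sum_{r=1}^m\sigma_{r-1}(\hat\xi_j)\,dt_r\Big).$$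 A smooth function $h$ on $D$ is a Killing potential if the vector field $X$ with $\omega(X,\cdot)=-dh$ is a Killing field of $g$. For a Killing potential $f$ put $$Scal_{f,p}(g)=f^2\,Scal(g)-2(p-1)f\,\Delta_g f-p(p-1)|df|_g^2,$$ where $Scal(g)$ is the scalar curvature and $\Delta_g=-\mathrm{div}\,\mathrm{grad}$; the metric is called $(f,p)$-extremal if $Scal_{f,p}(g)$ is a Killing potential. Then $(g,\omega)$ is $(\sigma_m,p)$-extremal if and only if there are a polynomial $P$ of degree $\le m$, independent of $j$, and real constants $b_{1j},b_{2j}$ such that for every $j$ $$\Theta_j(z)=P(z)+b_{1j}|z|^{p-1}+b_{2j}|z|^{p}\qquad(z\in I_j).$$ (Here $0\notin I_j$, so $z$ has constant sign on $I_j$ and one may write $z^{p-1},z^p$ whenever these powers are defined, up to the signs of the constants.) Furthermore, whenever the $\Theta_j$ are of this form: (i) $Scal_{\sigma_m,p}(g)$ is a linear combination, with constant coefficients, of $\sigma_{m-1}$ and $\sigma_m$; (ii) $Scal_{\sigma_m,p}(g)$ is constant if and only if it vanishes identically; (iii) $Scal_{\sigma_m,p}(g)$ vanishes identically if and only if $P(0)=P'(0)=0$.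 -/

import Mathlib

open scoped ContDiff

noncomputable section

/-! ### Riemannian geometry in a coordinate domain

`ι` indexes the coordinates; a metric is given by its matrix of coefficients `g x i j`. -/

namespace CoordGeom

variable {ι : Type} [Fintype ι] [DecidableEq ι]

/-- The partial derivative `∂ u / ∂ x_i`. -/
def pd (i : ι) (u : (ι → ℝ) → ℝ) (x : ι → ℝ) : ℝ :=
  fderiv ℝ u x (Pi.single i 1)

/-- The Christoffel symbol `Γ^k_{ij}` of the Levi-Civita connection of `g`. -/
def christoffel (g : (ι → ℝ) → Matrix ι ι ℝ) (k i j : ι) (x : ι → ℝ) : ℝ :=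
  (1 / 2) * ∑ l, (g x)⁻¹ k l *
    (pd i (fun y => g y j l) x + pd j (fun y => g y i l) x - pd l (fun y => g y i j) x)

/-- The component `R^l_{kij}` of the curvature tensor:
`R(∂_i, ∂_j) ∂_k = ∑ l, R^l_{kij} ∂_l` with `R(X, Y) = [∇_X, ∇_Y] - ∇_[X, Y]`. -/
def riemann (g : (ι → ℝ) → Matrix ι ι ℝ) (l k i j : ι) (x : ι → ℝ) : ℝ :=
  pd i (christoffel g l j k) x - pd j (christoffel g l i k) x +
    ∑ n, (christoffel g l i n x * christoffel g n j k x -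
      christoffel g l j n x * christoffel g n i k x)

/-- The Ricci tensor `Ric_{jk} = ∑ i, R^i_{kij}`. -/
def ricci (g : (ι → ℝ) → Matrix ι ι ℝ) (j k : ι) (x : ι → ℝ) : ℝ :=
  ∑ i, riemann g i k i j x

/-- The scalar curvature, the `g`-trace of the Ricci tensor. -/
def scalarCurvature (g : (ι → ℝ) → Matrix ι ι ℝ) (x : ι → ℝ) : ℝ :=
  ∑ j, ∑ k, (g x)⁻¹ j k * ricci g j k x

/-- The Laplacian with the sign `Δ_g = d^* d = - div grad`. -/
def laplacian (g : (ι → ℝ) → Matrix ι ι ℝ) (u : (ι → ℝ) → ℝ) (x : ι → ℝ) : ℝ :=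
  -∑ i, ∑ j, (g x)⁻¹ i j * (pd i (pd j u) x - ∑ k, christoffel g k i j x * pd k u x)

/-- The squared norm `|du|_g ^ 2` of the differential (equivalently, of the gradient). -/
def normSqDiff (g : (ι → ℝ) → Matrix ι ι ℝ) (u : (ι → ℝ) → ℝ) (x : ι → ℝ) : ℝ :=
  ∑ i, ∑ j, (g x)⁻¹ i j * pd i u x * pd j u x

/-- The vector field `X = ∑ k, X^k ∂_k` is a Killing field of `g` on `D`: it is smooth and the Lie
derivative `L_X g` vanishes on `D`. -/
def IsKillingField (g : (ι → ℝ) → Matrix ι ι ℝ) (D : Set (ι → ℝ)) (X : ι → (ι → ℝ) → ℝ) : Prop :=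
  (∀ k, ContDiffOn ℝ ∞ (X k) D) ∧
  ∀ x ∈ D, ∀ i j,
    ∑ k, (X k x * pd k (fun y => g y i j) x + g x k j * pd i (X k) x + g x i k * pd j (X k) x) = 0

/-- `h` is a Killing potential on `D` of the Kähler structure `(g, om)`: it is smooth and is a
hamiltonian, `om(X, ·) = -dh`, of a Killing field `X` of `g`
(`X` is then `J grad_g h`, up to the sign convention relating `g`, `J` and `om`). -/
def IsKillingPotential (g om : (ι → ℝ) → Matrix ι ι ℝ) (D : Set (ι → ℝ)) (h : (ι → ℝ) → ℝ) : Prop :=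
  ContDiffOn ℝ ∞ h D ∧
  ∃ X : ι → (ι → ℝ) → ℝ, IsKillingField g D X ∧
    ∀ x ∈ D, ∀ j, ∑ i, X i x * om x i j = -pd j h x

/-- The `(f, p)`-scalar curvature
`Scal_{f,p}(g) = f² Scal(g) - 2 (p - 1) f Δ_g f - p (p - 1) |df|²_g`. -/
def weightedScal (g : (ι → ℝ) → Matrix ι ι ℝ) (f : (ι → ℝ) → ℝ) (p : ℝ) (x : ι → ℝ) : ℝ :=
  f x ^ 2 * scalarCurvature g x - 2 * (p - 1) * f x * laplacian g f x
    - p * (p - 1) * normSqDiff g f x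

/-- The Kähler structure `(g, om)` is `(f, p)`-extremal on `D`: `f` is a Killing potential, and so is
the `(f, p)`-scalar curvature. -/
def IsWeightedExtremal (g om : (ι → ℝ) → Matrix ι ι ℝ) (D : Set (ι → ℝ))
    (f : (ι → ℝ) → ℝ) (p : ℝ) : Prop :=
  IsKillingPotential g om D f ∧ IsKillingPotential g om D (weightedScal g f p)

end CoordGeom

/-! ### Orthotoric metrics

Coordinates `x : Fin m ⊕ Fin m → ℝ`, with `ξ_j = x (inl j)` and `t_r = x (inr r)`. Indices run over
`Fin m = {0, …, m - 1}`, so the coordinate with index `r : Fin m` is the `(r + 1)`-st one. -/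

namespace Orthotoric

variable {m : ℕ}

/-- Points of the coordinate space with coordinates `(ξ, t)`. -/
abbrev Pt (m : ℕ) : Type := Fin m ⊕ Fin m → ℝ

/-- The coordinates `ξ_1, …, ξ_m`. -/
def xi (x : Pt m) (j : Fin m) : ℝ := x (Sum.inl j)

/-- `σ_k`, the `k`-th elementary symmetric function of `ξ_1, …, ξ_m`. -/
def sigma (k : ℕ) (x : Pt m) : ℝ :=
  ((Finset.univ : Finset (Fin m)).val.map (xi x)).esymm k

/-- `σ_k(ξ̂_j)`, the `k`-th elementary symmetric function of the `ξ_i` with `i ≠ j`. -/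
def sigmaHat (k : ℕ) (j : Fin m) (x : Pt m) : ℝ :=
  (((Finset.univ : Finset (Fin m)).erase j).val.map (xi x)).esymm k

/-- `Δ_j = ∏_{k ≠ j} (ξ_j - ξ_k)`. -/
def Del (j : Fin m) (x : Pt m) : ℝ :=
  ∏ k ∈ Finset.univ.erase j, (xi x j - xi x k)

/-- The components of the 1-form `dξ_j`. -/
def dxi (j : Fin m) : Fin m ⊕ Fin m → ℝ
  | Sum.inl i => if i = j then 1 else 0
  | Sum.inr _ => 0

/-- The components of the 1-form `θ_j = ∑_{r=1}^m σ_{r-1}(ξ̂_j) dt_r`. -/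
def theta (j : Fin m) (x : Pt m) : Fin m ⊕ Fin m → ℝ
  | Sum.inl _ => 0
  | Sum.inr r => sigmaHat r j x

/-- `g = ∑_j (Δ_j / Θ_j(ξ_j)) dξ_j² + ∑_j (Θ_j(ξ_j) / Δ_j) θ_j²`. -/
def metric (Θ : Fin m → ℝ → ℝ) (x : Pt m) : Matrix (Fin m ⊕ Fin m) (Fin m ⊕ Fin m) ℝ :=
  Matrix.of fun a b =>
    ∑ j, Del j x / Θ j (xi x j) * (dxi j a * dxi j b) +
    ∑ j, Θ j (xi x j) / Del j x * (theta j x a * theta j x b)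

/-- `ω = ∑_j dξ_j ∧ θ_j`. -/
def kahlerForm (x : Pt m) : Matrix (Fin m ⊕ Fin m) (Fin m ⊕ Fin m) ℝ :=
  Matrix.of fun a b => ∑ j, (dxi j a * theta j x b - dxi j b * theta j x a)

/-- On `D`, each `Θ_j` has the form `P(z) + b_{1j} z^{p-1} + b_{2j} z^p`, as a function of `z = ξ_j`.
Real powers are taken of `|z|`; the `z` involved are nonzero and of constant sign for each `j`, so
for an integer `p` this is the same as using the integer powers of `z`, up to the signs of the
constants. -/
def HasForm (Θ : Fin m → ℝ → ℝ) (D : Set (Pt m)) (p : ℝ) (P : Polynomial ℝ) (b₁ b₂ : Fin m → ℝ) :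
    Prop :=
  ∀ j, ∀ z ∈ (fun x : Pt m => xi x j) '' D,
    Θ j z = P.eval z + b₁ j * |z| ^ (p - 1) + b₂ j * |z| ^ p

end Orthotoric

end

open CoordGeom Orthotoric

/-! In the coordinates `(ξ, t)` the metric is block diagonal and independent of `t`. The `ξ`-block
is diagonal with entries `Δ_j / Θ_j`; the `t`-block is `G = Sᵀ diag(Θ_j / Δ_j) S`, where `S =
(σ_{r-1}(ξ̂_j))` is the Jacobian matrix of `(σ_1, …, σ_m)` in `ξ` and has an explicit
Vandermonde-type inverse. A direct computation gives `Scal = -∑ Θ_j'' / Δ_j`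
(`IsOrthotoric.scalarCurvature_eq`) and equally simple formulas for the Laplacian and the gradient
of functions of `ξ`. Since `σ_m` is affine in each `ξ_j` with `∂_j σ_m = σ_m / ξ_j`, they combine
(`IsOrthotoric.weightedScal_eq`) into `Scal_{σ_m,p} = -σ_m² ∑_j (E Θ_j)(ξ_j) / (ξ_j² Δ_j)`, with `E
φ = z² φ'' - 2(p-1) z φ' + p(p-1) φ`.

This is a function of `ξ` alone, and a Killing potential of that kind must be an affine combination
of the `σ_r` (`IsOrthotoric.eq_sum_of_isKillingPotential`): its hamiltonian field is tangent to the
`t`-directions and the Killing equation makes its components constant. So extremality says that the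
sum above is such a combination. Separation of variables (`exists_polynomial`) then shows that all
`E Θ_j` are one polynomial `R` of degree at most `m`.

The operator `E` multiplies `z^k` by `(k-p)(k-p+1)`, which is nonzero for `0 ≤ k ≤ m` exactly
because `p ∉ {0, …, m+1}`; hence `R = E P` for a polynomial `P` (`exists_eulerPoly_eq`), and `Θ_j -
P` lies in the kernel of `E`, spanned by `|z|^(p-1)` and `|z|^p` (`exists_eq_of_eulerOp_eq`).

Conversely, for a common polynomial `R = E P`, Lagrange interpolation (`sum_eval_div`) evaluates the
sum as `(-1)^m (R(0) σ_{m-1} + R'(0) σ_m)`, with `R(0) = p(p-1) P(0)` and `R'(0) = (p-1)(p-2)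
P'(0)`. This is a Killing potential, and the last three assertions follow since `σ_{m-1}`, `σ_m` and
`1` are linearly independent on `D`. -/

noncomputable section

open scoped Topology Matrix

set_option linter.unusedSectionVars false

/-! ### Partial derivatives, translation invariance and curvature in coordinates -/

namespace CoordGeom

variable {ι : Type} [Fintype ι] [DecidableEq ι]

/-- `u` is differentiable at `x`, with partial derivative `d` in the direction of `x_i`. -/
def HasPd (i : ι) (u : (ι → ℝ) → ℝ) (d : ℝ) (x : ι → ℝ) : Prop :=
  ∃ L : (ι → ℝ) →L[ℝ] ℝ, HasFDerivAt u L x ∧ L (Pi.single i 1) = d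

section HasPd

variable {i : ι} {u v : (ι → ℝ) → ℝ} {a b : ℝ} {x : ι → ℝ}

theorem HasPd.pd_eq (h : HasPd i u a x) : pd i u x = a := by
  obtain ⟨L, hL, rfl⟩ := h
  rw [pd, hL.fderiv]

theorem HasPd.differentiableAt (h : HasPd i u a x) : DifferentiableAt ℝ u x := by
  obtain ⟨L, hL, _⟩ := h
  exact hL.differentiableAt

theorem hasPd_pd (h : DifferentiableAt ℝ u x) : HasPd i u (pd i u x) x :=
  ⟨_, h.hasFDerivAt, rfl⟩

theorem HasPd.congr_val (h : HasPd i u a x) (hab : a = b) : HasPd i u b x := hab ▸ h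

theorem hasPd_const (i : ι) (c : ℝ) (x : ι → ℝ) : HasPd i (fun _ => c) 0 x :=
  ⟨_, hasFDerivAt_const c x, by simp⟩

theorem hasPd_apply (i j : ι) (x : ι → ℝ) :
    HasPd i (fun y => y j) (if i = j then 1 else 0) x :=
  ⟨_, hasFDerivAt_apply j x, by simp [Pi.single_apply, eq_comm]⟩

theorem HasPd.add (hu : HasPd i u a x) (hv : HasPd i v b x) :
    HasPd i (fun y => u y + v y) (a + b) x := by
  obtain ⟨L, hL, rfl⟩ := hu
  obtain ⟨M, hM, rfl⟩ := hv
  exact ⟨_, hL.add hM, by simp⟩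

theorem HasPd.sub (hu : HasPd i u a x) (hv : HasPd i v b x) :
    HasPd i (fun y => u y - v y) (a - b) x := by
  obtain ⟨L, hL, rfl⟩ := hu
  obtain ⟨M, hM, rfl⟩ := hv
  exact ⟨_, hL.sub hM, by simp⟩

theorem HasPd.mul (hu : HasPd i u a x) (hv : HasPd i v b x) :
    HasPd i (fun y => u y * v y) (a * v x + u x * b) x := by
  obtain ⟨L, hL, rfl⟩ := hu
  obtain ⟨M, hM, rfl⟩ := hv
  exact ⟨_, hL.mul hM, by simp; ring⟩

theorem HasPd.const_mul (c : ℝ) (hu : HasPd i u a x) :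
    HasPd i (fun y => c * u y) (c * a) x := by
  obtain ⟨L, hL, rfl⟩ := hu
  exact ⟨_, hL.const_mul c, by simp⟩

/-- The chain rule for a function of one variable. -/
theorem HasPd.comp_deriv {φ : ℝ → ℝ} (hφ : HasDerivAt φ b (u x)) (hu : HasPd i u a x) :
    HasPd i (fun y => φ (u y)) (b * a) x := by
  obtain ⟨L, hL, rfl⟩ := hu
  exact ⟨_, hφ.comp_hasFDerivAt x hL, by simp⟩

theorem HasPd.inv (hu : HasPd i u a x) (h0 : u x ≠ 0) :
    HasPd i (fun y => (u y)⁻¹) (-(u x ^ 2)⁻¹ * a) x :=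
  HasPd.comp_deriv (hasDerivAt_inv h0) hu

theorem HasPd.sum {κ : Type*} {s : Finset κ} {w : κ → (ι → ℝ) → ℝ} {c : κ → ℝ}
    (h : ∀ k ∈ s, HasPd i (w k) (c k) x) :
    HasPd i (fun y => ∑ k ∈ s, w k y) (∑ k ∈ s, c k) x := by
  classical
  induction s using Finset.induction_on with
  | empty => simpa using hasPd_const i 0 x
  | insert k s hk ih =>
    simp only [Finset.sum_insert hk]
    exact (h k (by simp)).add (ih fun l hl => h l (by simp [hl]))

theorem HasPd.congr_of_eventuallyEq (hu : HasPd i u a x) (h : v =ᶠ[𝓝 x] u) : HasPd i v a x := by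
  obtain ⟨L, hL, rfl⟩ := hu
  exact ⟨L, hL.congr_of_eventuallyEq h, rfl⟩

theorem HasPd.congr_on {D : Set (ι → ℝ)} (hu : HasPd i u a x) (hD : IsOpen D) (hx : x ∈ D)
    (h : ∀ y ∈ D, v y = u y) : HasPd i v a x :=
  hu.congr_of_eventuallyEq (Filter.eventually_of_mem (hD.mem_nhds hx) h)

theorem pd_congr_on {D : Set (ι → ℝ)} (hD : IsOpen D) (hx : x ∈ D)
    (h : ∀ y ∈ D, v y = u y) : pd i v x = pd i u x := by
  have h' : v =ᶠ[𝓝 x] u := Filter.eventually_of_mem (hD.mem_nhds hx) h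
  rw [pd, pd, h'.fderiv_eq]

/-- A partial derivative can be computed along the coordinate line. -/
theorem HasPd.of_line (hu : DifferentiableAt ℝ u x)
    (h : HasDerivAt (fun s : ℝ => u (x + s • Pi.single i 1)) a 0) : HasPd i u a x := by
  refine ⟨_, hu.hasFDerivAt, ?_⟩
  have h1 : HasDerivAt (fun s : ℝ => x + s • (Pi.single i 1 : ι → ℝ)) (Pi.single i 1) 0 := by
    simpa using ((hasDerivAt_id (0 : ℝ)).smul_const (Pi.single i 1 : ι → ℝ)).const_add x
  have h2 : HasFDerivAt u (fderiv ℝ u x) (x + (0 : ℝ) • (Pi.single i 1 : ι → ℝ)) := by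
    simpa using hu.hasFDerivAt
  exact (h2.comp_hasDerivAt 0 h1).unique h

end HasPd

/-- `u` is invariant under translations in the direction of `x_a`. -/
def InvariantAlong (a : ι) (u : (ι → ℝ) → ℝ) : Prop :=
  ∀ (x : ι → ℝ) (s : ℝ), u (x + s • Pi.single a 1) = u x

section Invariant

variable {a : ι} {u : (ι → ℝ) → ℝ}

theorem InvariantAlong.pd_eq_zero (h : InvariantAlong a u) (x : ι → ℝ) : pd a u x = 0 := by
  by_cases hu : DifferentiableAt ℝ u x
  · refine (HasPd.of_line hu ?_).pd_eq
    simp only [h x]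
    exact hasDerivAt_const _ _
  -- At a point of non-differentiability `fderiv` is zero by default, so no smoothness is needed.
  · simp [pd, fderiv_zero_of_not_differentiableAt hu]

theorem InvariantAlong.pd (h : InvariantAlong a u) (i : ι) : InvariantAlong a (pd i u) := by
  intro x s
  have := fderiv_comp_add_right (𝕜 := ℝ) (f := u) (x := x) (s • (Pi.single a 1 : ι → ℝ))
  simp only [h _ s] at this
  rw [CoordGeom.pd, CoordGeom.pd, ← this]

variable {g : (ι → ℝ) → Matrix ι ι ℝ}

theorem invariantAlong_christoffel
    (hg : ∀ (x : ι → ℝ) (s : ℝ), g (x + s • Pi.single a 1) = g x) (k i j : ι) :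
    InvariantAlong a (christoffel g k i j) := by
  intro x s
  have h : ∀ i j l, CoordGeom.pd l (fun y => g y i j) (x + s • Pi.single a 1) =
      CoordGeom.pd l (fun y => g y i j) x := fun i j l =>
    InvariantAlong.pd (u := fun y => g y i j) (fun y r => by simp only [hg]) l x s
  simp only [christoffel, hg, h]

theorem invariantAlong_scalarCurvature
    (hg : ∀ (x : ι → ℝ) (s : ℝ), g (x + s • Pi.single a 1) = g x) :
    InvariantAlong a (scalarCurvature g) := by
  intro x s
  have h1 := fun k i j => invariantAlong_christoffel hg k i j x s
  have h2 := fun l k i j => (invariantAlong_christoffel hg k i j).pd l x s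
  simp only [scalarCurvature, ricci, riemann, hg, h1, h2]

/-- Everything in the definition is built from `g`, `u` and their partial derivatives, and `pd`
commutes with translations even where it takes its default value. The invariance therefore holds on
the whole space, and nothing is required of the shape of `D` in the `t`-directions. -/
theorem invariantAlong_weightedScal
    (hg : ∀ (x : ι → ℝ) (s : ℝ), g (x + s • Pi.single a 1) = g x) (hu : InvariantAlong a u)
    (p : ℝ) : InvariantAlong a (weightedScal g u p) := by
  intro x s
  have h1 := fun k i j => invariantAlong_christoffel hg k i j x s
  have h2 := fun k => hu.pd k x s
  have h3 := fun k l => (hu.pd k).pd l x s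
  simp only [weightedScal, laplacian, normSqDiff, invariantAlong_scalarCurvature hg x s, hu x s,
    hg, h1, h2, h3]

end Invariant

section Smooth

variable {D : Set (ι → ℝ)} {g : (ι → ℝ) → Matrix ι ι ℝ}

theorem contDiffOn_pd {u : (ι → ℝ) → ℝ} (hD : IsOpen D) (hu : ContDiffOn ℝ ∞ u D) (i : ι) :
    ContDiffOn ℝ ∞ (pd i u) D :=
  (hu.fderiv_of_isOpen hD (by simp)).clm_apply contDiffOn_const

theorem contDiffOn_christoffel (hD : IsOpen D) (hg : ∀ i j, ContDiffOn ℝ ∞ (fun y => g y i j) D)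
    (hg' : ∀ i j, ContDiffOn ℝ ∞ (fun y => (g y)⁻¹ i j) D) (k i j : ι) :
    ContDiffOn ℝ ∞ (christoffel g k i j) D := by
  have h := fun i j l => contDiffOn_pd hD (hg i j) l
  unfold christoffel
  refine contDiffOn_const.mul (ContDiffOn.sum fun l _ => (hg' k l).mul ?_)
  exact ((h _ _ _).add (h _ _ _)).sub (h _ _ _)

theorem differentiableAt_of_contDiffOn {u : (ι → ℝ) → ℝ} (hD : IsOpen D)
    (hu : ContDiffOn ℝ ∞ u D) {x : ι → ℝ} (hx : x ∈ D) : DifferentiableAt ℝ u x :=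
  (hu.contDiffAt (hD.mem_nhds hx)).differentiableAt (by simp)

/-- The Ricci tensor in terms of the trace `T k = ∑ i, Γ^i_{ik}` of the Christoffel symbols. -/
theorem ricci_eq_of_trace {T : ι → (ι → ℝ) → ℝ} {x : ι → ℝ} (hD : IsOpen D) (hx : x ∈ D)
    (hΓ : ∀ k i j, ContDiffOn ℝ ∞ (christoffel g k i j) D)
    (hT : ∀ k, ∀ y ∈ D, ∑ i, christoffel g i i k y = T k y) (j k : ι) :
    ricci g j k x = ∑ i, pd i (christoffel g i j k) x - pd j (T k) x +
      ∑ n, T n x * christoffel g n j k x -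
      ∑ i, ∑ n, christoffel g i j n x * christoffel g n i k x := by
  have h : pd j (T k) x = ∑ i, pd j (christoffel g i i k) x := by
    rw [← pd_congr_on hD hx (hT k)]
    exact (HasPd.sum fun i _ => hasPd_pd (differentiableAt_of_contDiffOn hD (hΓ i i k) hx)).pd_eq
  have h2 : ∑ n, T n x * christoffel g n j k x =
      ∑ i, ∑ n, christoffel g i i n x * christoffel g n j k x := by
    rw [Finset.sum_comm]
    exact Finset.sum_congr rfl fun n _ => by rw [← hT n x hx, Finset.sum_mul]
  rw [h, h2]
  simp only [ricci, riemann, Finset.sum_add_distrib, Finset.sum_sub_distrib]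
  ring

/-- A differentiable function all of whose partial derivatives vanish on a connected open set is
constant there. -/
theorem exists_const_of_pd_eq_zero {u : (ι → ℝ) → ℝ} (hD : IsOpen D) (hDc : IsPreconnected D)
    (hu : ContDiffOn ℝ ∞ u D) (h : ∀ x ∈ D, ∀ i, pd i u x = 0) : ∃ c, ∀ x ∈ D, u x = c := by
  refine hD.exists_is_const_of_fderiv_eq_zero hDc (𝕜 := ℝ) (hu.differentiableOn (by simp)) ?_
  intro x hx
  ext v
  have hv : v = ∑ i, v i • (Pi.single i 1 : ι → ℝ) := by
    ext j
    simp [Finset.sum_apply, Pi.single_apply]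
  rw [hv, map_sum]
  simp only [map_smul]
  exact Finset.sum_eq_zero fun i _ => by
    have := h x hx i
    rw [pd] at this
    simp [this]

end Smooth

/-- The logarithmic form of the product rule. -/
theorem HasPd.prod_log {κ : Type*} {s : Finset κ} {w : κ → (ι → ℝ) → ℝ} {c : κ → ℝ}
    {i : ι} {x : ι → ℝ} (h : ∀ k ∈ s, HasPd i (w k) (w k x * c k) x) :
    HasPd i (fun y => ∏ k ∈ s, w k y) ((∏ k ∈ s, w k x) * ∑ k ∈ s, c k) x := by
  classical
  induction s using Finset.induction_on with
  | empty => simpa using hasPd_const i 1 x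
  | insert k s hk ih =>
    simp only [Finset.sum_insert hk, Finset.prod_insert hk]
    exact ((h k (by simp)).mul (ih fun l hl => h l (by simp [hl]))).congr_val (by ring)

end CoordGeom

/-! ### Elementary symmetric functions of the `ξ_j` and their derivatives -/

theorem Finset.esymm_insert {σ R : Type*} [DecidableEq σ] [CommSemiring R] (f : σ → R)
    {s : Finset σ} {a : σ} (ha : a ∉ s) (r : ℕ) :
    ((insert a s).val.map f).esymm (r + 1) =
      (s.val.map f).esymm (r + 1) + f a * (s.val.map f).esymm r := by
  rw [Finset.insert_val_of_notMem ha, Multiset.map_cons, Multiset.esymm,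
    Multiset.powersetCard_cons, Multiset.map_add, Multiset.sum_add, Multiset.map_map]
  simp [Multiset.esymm, Multiset.sum_map_mul_left]

namespace Orthotoric

variable {m : ℕ}

section SymmetricFunctions

theorem xi_add_inr (x : Pt m) (a : Fin m) (s : ℝ) :
    xi (x + s • Pi.single (Sum.inr a) 1) = xi x := by
  ext j
  simp [xi]

theorem xi_add_inl (x : Pt m) (i j : Fin m) (s : ℝ) :
    xi (x + s • Pi.single (Sum.inl i) 1) j = xi x j + if j = i then s else 0 := by
  simp [xi, Pi.single_apply]

theorem contDiff_xi (j : Fin m) : ContDiff ℝ ∞ (fun x : Pt m => xi x j) := by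
  unfold xi
  fun_prop

theorem contDiff_esymm (s : Finset (Fin m)) (r : ℕ) :
    ContDiff ℝ ∞ (fun x : Pt m => (s.val.map (xi x)).esymm r) := by
  simp only [Finset.esymm_map_val]
  exact ContDiff.sum fun t _ => contDiff_prod fun j _ => contDiff_xi j

theorem contDiff_sigma (r : ℕ) : ContDiff ℝ ∞ (sigma r : Pt m → ℝ) := contDiff_esymm _ _

theorem contDiff_sigmaHat (r : ℕ) (j : Fin m) : ContDiff ℝ ∞ (sigmaHat r j : Pt m → ℝ) :=
  contDiff_esymm _ _

theorem contDiff_Del (j : Fin m) : ContDiff ℝ ∞ (Del j : Pt m → ℝ) :=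
  contDiff_prod fun k _ => (contDiff_xi j).sub (contDiff_xi k)

theorem hasPd_xi (k j : Fin m) (x : Pt m) :
    HasPd (Sum.inl k) (fun y => xi y j) (if k = j then 1 else 0) x :=
  (hasPd_apply (Sum.inl k) (Sum.inl j) x).congr_val (by simp)

theorem hasPd_esymm_of_notMem {s : Finset (Fin m)} {k : Fin m} (hk : k ∉ s) (r : ℕ) (x : Pt m) :
    HasPd (Sum.inl k) (fun y : Pt m => (s.val.map (xi y)).esymm r) 0 x := by
  refine HasPd.of_line ((contDiff_esymm s r).differentiable (by simp) x) ?_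
  have h : ∀ t : ℝ, s.val.map (xi (x + t • Pi.single (Sum.inl k) 1)) = s.val.map (xi x) :=
    fun t => Multiset.map_congr rfl fun j hj => by
      have hjk : j ≠ k := fun h => hk (h ▸ hj)
      simp [xi_add_inl, hjk]
  simp only [h]
  exact hasDerivAt_const _ _

theorem hasPd_esymm_of_mem {s : Finset (Fin m)} {k : Fin m} (hk : k ∈ s) (r : ℕ) (x : Pt m) :
    HasPd (Sum.inl k) (fun y : Pt m => (s.val.map (xi y)).esymm (r + 1))
      (((s.erase k).val.map (xi x)).esymm r) x := by
  have h : ∀ y : Pt m, (s.val.map (xi y)).esymm (r + 1) = ((s.erase k).val.map (xi y)).esymm (r + 1)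
      + xi y k * ((s.erase k).val.map (xi y)).esymm r := fun y => by
    conv_lhs => rw [← Finset.insert_erase hk]
    exact Finset.esymm_insert _ (Finset.notMem_erase k s) r
  simp only [h]
  exact ((hasPd_esymm_of_notMem (Finset.notMem_erase k s) _ x).add ((hasPd_xi k k x).mul
    (hasPd_esymm_of_notMem (Finset.notMem_erase k s) _ x))).congr_val (by simp)

/-- Consequently `∑_j σ_{r-1}(ξ̂_j) dξ_j = dσ_r`, so `ω = ∑_r dσ_r ∧ dt_r`, and the `σ_r` are
momenta for the fields `∂/∂t_r`. -/
theorem hasPd_sigma (r : ℕ) (k : Fin m) (x : Pt m) :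
    HasPd (Sum.inl k) (sigma (r + 1)) (sigmaHat r k x) x :=
  hasPd_esymm_of_mem (Finset.mem_univ k) r x

/-- `σ_r(ξ̂_j) - σ_r(ξ̂_k) = (ξ_k - ξ_j) σ_{r-1}(ξ̂_j, ξ̂_k)`. -/
theorem sigmaHat_sub_sigmaHat {j k : Fin m} (hjk : j ≠ k) (r : ℕ) (x : Pt m) :
    sigmaHat (r + 1) j x - sigmaHat (r + 1) k x =
      (xi x k - xi x j) * ((((Finset.univ.erase j).erase k).val.map (xi x)).esymm r) := by
  have h1 : Finset.univ.erase j = insert k ((Finset.univ.erase j).erase k) :=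
    (Finset.insert_erase (by simp [hjk.symm])).symm
  have h2 : Finset.univ.erase k = insert j ((Finset.univ.erase j).erase k) := by
    rw [Finset.erase_right_comm]
    exact (Finset.insert_erase (by simp [hjk])).symm
  rw [sigmaHat, sigmaHat, h2]
  conv_lhs => enter [1]; rw [h1]
  rw [Finset.esymm_insert _ (by simp), Finset.esymm_insert _ (by simp)]
  ring

/-- The difference quotient expresses the derivative of row `j` of `sigmaMat` through rows `j` and
`k` of the same matrix; this lets derivatives of the fibre metric be written in the coframe `θ_j`.
The convention `0⁻¹ = 0` covers `j = k`. -/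
theorem hasPd_sigmaHat {x : Pt m} (hx : Function.Injective (xi x)) (r : ℕ) (j k : Fin m) :
    HasPd (Sum.inl k) (sigmaHat r j)
      ((xi x k - xi x j)⁻¹ * (sigmaHat r j x - sigmaHat r k x)) x := by
  rcases r with _ | r
  · have h : ∀ j, (sigmaHat 0 j : Pt m → ℝ) = fun _ => 1 := fun j => by
      ext y
      simp [sigmaHat, Multiset.esymm]
    simpa [h] using hasPd_const (Sum.inl k) 1 x
  by_cases hjk : j = k
  · subst hjk
    exact (hasPd_esymm_of_notMem (Finset.notMem_erase j Finset.univ) (r + 1) x).congr_val (by simp)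
  · refine (hasPd_esymm_of_mem (s := Finset.univ.erase j) (k := k) (by simp [Ne.symm hjk])
      r x).congr_val ?_
    have h0 : xi x k - xi x j ≠ 0 := sub_ne_zero.2 fun h => hjk (hx h).symm
    rw [sigmaHat_sub_sigmaHat hjk, inv_mul_cancel_left₀ h0]

end SymmetricFunctions

/-! ### The factors `Δ_j` and the Vandermonde-type inverse of `σ_{r-1}(ξ̂_j)` -/

/-- `∑_{l ≠ j} 1 / (ξ_j - ξ_l)`, the logarithmic derivative of `Δ_j` in `ξ_j`; the term with
`l = j` is `0⁻¹ = 0`. -/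
def sumInv (x : Pt m) (j : Fin m) : ℝ := ∑ l, (xi x j - xi x l)⁻¹

theorem Del_ne_zero {x : Pt m} (hx : Function.Injective (xi x)) (j : Fin m) : Del j x ≠ 0 :=
  Finset.prod_ne_zero_iff.2 fun _ hk =>
    sub_ne_zero.2 fun h => (Finset.ne_of_mem_erase hk) (hx h).symm

theorem hasPd_Del {x : Pt m} (hx : Function.Injective (xi x)) (j k : Fin m) :
    HasPd (Sum.inl k) (Del j)
      (Del j x * ((xi x k - xi x j)⁻¹ + if k = j then sumInv x j else 0)) x := by
  have h : ∀ l ∈ Finset.univ.erase j, HasPd (Sum.inl k) (fun y : Pt m => xi y j - xi y l)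
      ((xi x j - xi x l) * (((if k = j then 1 else 0) - if k = l then 1 else 0)
        * (xi x j - xi x l)⁻¹)) x := by
    intro l hl
    have h0 : xi x j - xi x l ≠ 0 := sub_ne_zero.2 fun h => (Finset.ne_of_mem_erase hl) (hx h).symm
    refine ((hasPd_xi k j x).sub (hasPd_xi k l x)).congr_val ?_
    field_simp
  refine (HasPd.prod_log h).congr_val ?_
  rw [Del]
  congr 1
  -- The omitted index `l = j` contributes a multiple of `0⁻¹ = 0`, so the sum may run over all
  -- indices.
  rw [Finset.sum_erase _ (by simp)]
  · simp only [sub_mul, Finset.sum_sub_distrib, ite_mul, one_mul, zero_mul, sumInv]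
    rw [Finset.sum_ite_eq Finset.univ k, ← neg_sub (xi x k) (xi x j), inv_neg]
    by_cases hkj : k = j <;> simp [hkj]

/-- The inverse of the matrix `σ_{r-1}(ξ̂_j)`. -/
def sigmaInv (x : Pt m) : Matrix (Fin m) (Fin m) ℝ :=
  Matrix.of fun r j => (-1) ^ (r : ℕ) * xi x j ^ (m - 1 - r) / Del j x

/-- The matrix `σ_{r-1}(ξ̂_j)`. -/
def sigmaMat (x : Pt m) : Matrix (Fin m) (Fin m) ℝ := Matrix.of fun j r => sigmaHat r j x

/-- Vieta's formula for the monic polynomial with roots `ξ_k`, `k ≠ j`. -/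
theorem sum_sigmaHat_mul_pow (x : Pt m) (j : Fin m) (z : ℝ) :
    ∑ r : Fin m, sigmaHat r j x * ((-1) ^ (r : ℕ) * z ^ (m - 1 - r)) =
      ∏ k ∈ Finset.univ.erase j, (z - xi x k) := by
  have hm : 0 < m := j.pos
  have h := congrArg (Polynomial.eval z)
    (Multiset.prod_X_sub_X_eq_sum_esymm ((Finset.univ.erase j).val.map (xi x)))
  have hc : Multiset.card ((Finset.univ.erase j).val.map (xi x)) = m - 1 := by
    rw [Multiset.card_map, Finset.card_val, Finset.card_erase_of_mem (Finset.mem_univ j)]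
    simp
  rw [hc, Nat.sub_add_cancel hm, Multiset.map_map, Polynomial.eval_finsetSum,
    Finset.sum_range] at h
  have h2 : (Multiset.map ((fun t => Polynomial.X - Polynomial.C t) ∘ xi x)
      (Finset.univ.erase j).val).prod = ∏ k ∈ Finset.univ.erase j,
        (Polynomial.X - Polynomial.C (xi x k)) := rfl
  rw [h2, Polynomial.eval_prod] at h
  simp only [Polynomial.eval_sub, Polynomial.eval_X, Polynomial.eval_C] at h
  rw [h]
  refine Finset.sum_congr rfl fun r _ => ?_
  simp [sigmaHat]
  ring

/-- By `sum_sigmaHat_mul_pow` at `z = ξ_j`, the `(i, j)` entry is `∏_{k ≠ i} (ξ_j - ξ_k) / Δ_j`: the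
Lagrange basis of the nodes evaluated at a node. -/
theorem sigmaMat_mul_sigmaInv {x : Pt m} (hx : Function.Injective (xi x)) :
    sigmaMat x * sigmaInv x = 1 := by
  ext i j
  have h : ∑ r : Fin m, sigmaHat r i x * ((-1) ^ (r : ℕ) * xi x j ^ (m - 1 - r) / Del j x) =
      (∏ k ∈ Finset.univ.erase i, (xi x j - xi x k)) / Del j x := by
    rw [← sum_sigmaHat_mul_pow, Finset.sum_div]
    exact Finset.sum_congr rfl fun r _ => by ring
  simp only [Matrix.mul_apply, sigmaMat, sigmaInv, Matrix.of_apply, h, Matrix.one_apply]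
  split_ifs with hij
  · subst hij
    exact div_self (Del_ne_zero hx i)
  · rw [Finset.prod_eq_zero (Finset.mem_erase.2 ⟨fun h => hij h.symm, Finset.mem_univ j⟩)
      (sub_self _), zero_div]

theorem sigmaInv_mul_sigmaMat {x : Pt m} (hx : Function.Injective (xi x)) :
    sigmaInv x * sigmaMat x = 1 :=
  mul_eq_one_comm.1 (sigmaMat_mul_sigmaInv hx)

theorem eq_zero_of_sum_sigmaHat {x : Pt m} (hx : Function.Injective (xi x)) {c : Fin m → ℝ}
    (h : ∀ j, ∑ r : Fin m, c r * sigmaHat r j x = 0) (r : Fin m) : c r = 0 := by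
  have h1 : sigmaMat x *ᵥ c = 0 := by
    ext j
    simpa [Matrix.mulVec, dotProduct, sigmaMat, mul_comm] using h j
  have h2 : c = sigmaInv x *ᵥ (sigmaMat x *ᵥ c) := by
    rw [Matrix.mulVec_mulVec, sigmaInv_mul_sigmaMat hx, Matrix.one_mulVec]
  rw [h2, h1]
  simp

theorem contDiffOn_sigmaInv {D : Set (Pt m)} (hinj : ∀ x ∈ D, Function.Injective (xi x))
    (r j : Fin m) : ContDiffOn ℝ ∞ (fun x => sigmaInv x r j) D := by
  simp only [sigmaInv, Matrix.of_apply]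
  exact (contDiff_const.mul ((contDiff_xi j).pow _)).contDiffOn.div (contDiff_Del j).contDiffOn
    fun x hx => Del_ne_zero (hinj x hx) j

/-! ### The metric in block form and the derivatives of its coefficients -/

/-- The standing assumptions under which `metric Θ` is an orthotoric metric on `D`. -/
structure IsOrthotoric (Θ : Fin m → ℝ → ℝ) (D : Set (Pt m)) : Prop where
  isOpen : IsOpen D
  smooth : ∀ j, ContDiffOn ℝ ∞ (Θ j) ((fun x : Pt m => xi x j) '' D)
  inj : ∀ x ∈ D, Function.Injective (xi x)
  pos : ∀ x ∈ D, ∀ j, 0 < Θ j (xi x j) / Del j x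

/-- The coefficient `Δ_j / Θ_j(ξ_j)` of `dξ_j²`. -/
def baseCoeff (Θ : Fin m → ℝ → ℝ) (j : Fin m) (x : Pt m) : ℝ := Del j x / Θ j (xi x j)

/-- The coefficient `Θ_j(ξ_j) / Δ_j` of `θ_j²`. -/
def fibreCoeff (Θ : Fin m → ℝ → ℝ) (j : Fin m) (x : Pt m) : ℝ := Θ j (xi x j) / Del j x

/-- The logarithmic derivative of `Θ_j` at `ξ_j`. -/
def logDerivTheta (Θ : Fin m → ℝ → ℝ) (x : Pt m) (j : Fin m) : ℝ :=
  deriv (Θ j) (xi x j) / Θ j (xi x j)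

/-- The logarithmic derivative of `Δ_j / Θ_j(ξ_j)` with respect to `ξ_k`. -/
def logDerivBase (Θ : Fin m → ℝ → ℝ) (x : Pt m) (j k : Fin m) : ℝ :=
  (xi x k - xi x j)⁻¹ + if k = j then sumInv x j - logDerivTheta Θ x j else 0

/-- The matrix of the metric in the directions `∂/∂t_r`. -/
def fibreMat (Θ : Fin m → ℝ → ℝ) (x : Pt m) : Matrix (Fin m) (Fin m) ℝ :=
  (sigmaMat x)ᵀ * Matrix.diagonal (fun j => fibreCoeff Θ j x) * sigmaMat x

/-- The inverse of `fibreMat`. -/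
def fibreInv (Θ : Fin m → ℝ → ℝ) (x : Pt m) : Matrix (Fin m) (Fin m) ℝ :=
  sigmaInv x * Matrix.diagonal (fun j => baseCoeff Θ j x) * (sigmaInv x)ᵀ

/-- The derivative of `fibreMat` with respect to `ξ_k`. -/
def fibreDer (Θ : Fin m → ℝ → ℝ) (k : Fin m) (x : Pt m) : Matrix (Fin m) (Fin m) ℝ :=
  Matrix.of fun a b => pd (Sum.inl k) (fun y => fibreMat Θ y a b) x

/-- The derivative of `fibreMat` with respect to `ξ_k`, in the coframe `θ_j`. -/
def frameDer (Θ : Fin m → ℝ → ℝ) (k : Fin m) (x : Pt m) : Matrix (Fin m) (Fin m) ℝ :=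
  Matrix.of fun j l =>
    (if j = l then fibreCoeff Θ j x * (2 * (xi x k - xi x j)⁻¹ - logDerivBase Θ x j k) else 0)
    - (if l = k then fibreCoeff Θ j x * (xi x k - xi x j)⁻¹ else 0)
    - (if j = k then fibreCoeff Θ l x * (xi x k - xi x l)⁻¹ else 0)

variable {Θ : Fin m → ℝ → ℝ} {D : Set (Pt m)}

theorem fibreMat_apply (Θ : Fin m → ℝ → ℝ) (x : Pt m) (a b : Fin m) :
    fibreMat Θ x a b = ∑ j, sigmaHat a j x * fibreCoeff Θ j x * sigmaHat b j x := by
  rw [fibreMat, Matrix.mul_apply]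
  exact Finset.sum_congr rfl fun j _ => by
    rw [Matrix.mul_diagonal]
    simp only [sigmaMat, Matrix.transpose_apply, Matrix.of_apply]

theorem fibreInv_apply (Θ : Fin m → ℝ → ℝ) (x : Pt m) (a b : Fin m) :
    fibreInv Θ x a b = ∑ j, sigmaInv x a j * baseCoeff Θ j x * sigmaInv x b j := by
  rw [fibreInv, Matrix.mul_apply]
  exact Finset.sum_congr rfl fun j _ => by rw [Matrix.mul_diagonal, Matrix.transpose_apply]

theorem metric_eq_fromBlocks (Θ : Fin m → ℝ → ℝ) (x : Pt m) :
    metric Θ x = Matrix.fromBlocks (Matrix.diagonal fun j => baseCoeff Θ j x) 0 0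
      (fibreMat Θ x) := by
  ext a b
  rcases a with a | a <;> rcases b with b | b <;>
    simp [metric, dxi, theta, baseCoeff, fibreCoeff, fibreMat, Matrix.diagonal_apply,
      Matrix.mul_apply, sigmaMat, Finset.sum_ite_eq, mul_comm, mul_left_comm]
  · split_ifs with hab
    · rw [hab]
    · rfl
  · exact Finset.sum_congr rfl fun j _ => by ring

theorem metric_add_inr (Θ : Fin m → ℝ → ℝ) (a : Fin m) (x : Pt m) (s : ℝ) :
    metric Θ (x + s • Pi.single (Sum.inr a) 1) = metric Θ x := by
  have h : ∀ j, theta j (x + s • Pi.single (Sum.inr a) 1) = theta j x := fun j => by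
    ext b
    rcases b with b | b <;> simp [theta, sigmaHat, xi_add_inr]
  simp only [metric, Del, h, xi_add_inr]

theorem invariantAlong_sigma (r : ℕ) (a : Fin m) :
    InvariantAlong (Sum.inr a) (sigma r : Pt m → ℝ) := fun x s => by
  simp only [sigma, xi_add_inr]

theorem fibreMat_symm (Θ : Fin m → ℝ → ℝ) (x : Pt m) : (fibreMat Θ x)ᵀ = fibreMat Θ x := by
  simp [fibreMat, Matrix.transpose_mul, Matrix.mul_assoc]

theorem fibreInv_symm (Θ : Fin m → ℝ → ℝ) (x : Pt m) : (fibreInv Θ x)ᵀ = fibreInv Θ x := by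
  simp [fibreInv, Matrix.transpose_mul, Matrix.mul_assoc]

theorem fibreDer_symm (Θ : Fin m → ℝ → ℝ) (k : Fin m) (x : Pt m) :
    (fibreDer Θ k x)ᵀ = fibreDer Θ k x := by
  ext a b
  have h : ∀ y, fibreMat Θ y b a = fibreMat Θ y a b := fun y =>
    congrFun (congrFun (fibreMat_symm Θ y) a) b
  simp only [Matrix.transpose_apply, fibreDer, Matrix.of_apply, h]

namespace IsOrthotoric

theorem Theta_ne_zero (h : IsOrthotoric Θ D) {x : Pt m} (hx : x ∈ D) (j : Fin m) :
    Θ j (xi x j) ≠ 0 := fun h0 => by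
  have := h.pos x hx j
  simp [h0] at this

theorem Del_ne_zero (h : IsOrthotoric Θ D) {x : Pt m} (hx : x ∈ D) (j : Fin m) :
    Del j x ≠ 0 := Orthotoric.Del_ne_zero (h.inj x hx) j

theorem baseCoeff_ne_zero (h : IsOrthotoric Θ D) {x : Pt m} (hx : x ∈ D) (j : Fin m) :
    baseCoeff Θ j x ≠ 0 := div_ne_zero (h.Del_ne_zero hx j) (h.Theta_ne_zero hx j)

theorem fibreCoeff_eq_inv (Θ : Fin m → ℝ → ℝ) (j : Fin m) (x : Pt m) :
    fibreCoeff Θ j x = (baseCoeff Θ j x)⁻¹ := by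
  simp [baseCoeff, fibreCoeff]

theorem fibreCoeff_mul_baseCoeff (h : IsOrthotoric Θ D) {x : Pt m} (hx : x ∈ D) (j : Fin m) :
    fibreCoeff Θ j x * baseCoeff Θ j x = 1 := by
  rw [fibreCoeff_eq_inv, inv_mul_cancel₀ (h.baseCoeff_ne_zero hx j)]

theorem baseCoeff_mul_fibreCoeff (h : IsOrthotoric Θ D) {x : Pt m} (hx : x ∈ D) (j : Fin m) :
    baseCoeff Θ j x * fibreCoeff Θ j x = 1 := by
  rw [mul_comm, h.fibreCoeff_mul_baseCoeff hx]

theorem isOpen_image (h : IsOrthotoric Θ D) (j : Fin m) :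
    IsOpen ((fun x : Pt m => xi x j) '' D) :=
  isOpenMap_eval (X := fun _ : Fin m ⊕ Fin m => ℝ) (Sum.inl j) D h.isOpen

theorem hasDerivAt_Theta (h : IsOrthotoric Θ D) {j : Fin m} {z : ℝ}
    (hz : z ∈ (fun x : Pt m => xi x j) '' D) : HasDerivAt (Θ j) (deriv (Θ j) z) z :=
  (((h.smooth j).contDiffAt ((h.isOpen_image j).mem_nhds hz)).differentiableAt
    (by simp)).hasDerivAt

theorem contDiffOn_deriv_Theta (h : IsOrthotoric Θ D) (j : Fin m) :
    ContDiffOn ℝ ∞ (deriv (Θ j)) ((fun x : Pt m => xi x j) '' D) :=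
  (h.smooth j).deriv_of_isOpen (h.isOpen_image j) (by simp)

theorem hasDerivAt_deriv_Theta (h : IsOrthotoric Θ D) {j : Fin m} {z : ℝ}
    (hz : z ∈ (fun x : Pt m => xi x j) '' D) :
    HasDerivAt (deriv (Θ j)) (deriv (deriv (Θ j)) z) z :=
  (((h.contDiffOn_deriv_Theta j).contDiffAt ((h.isOpen_image j).mem_nhds hz)).differentiableAt
    (by simp)).hasDerivAt

theorem hasPd_Theta (h : IsOrthotoric Θ D) {x : Pt m} (hx : x ∈ D) (j k : Fin m) :
    HasPd (Sum.inl k) (fun y : Pt m => Θ j (xi y j))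
      (deriv (Θ j) (xi x j) * if k = j then 1 else 0) x :=
  HasPd.comp_deriv (h.hasDerivAt_Theta ⟨x, hx, rfl⟩) (hasPd_xi k j x)

theorem hasPd_deriv_Theta (h : IsOrthotoric Θ D) {x : Pt m} (hx : x ∈ D) (j k : Fin m) :
    HasPd (Sum.inl k) (fun y : Pt m => deriv (Θ j) (xi y j))
      (deriv (deriv (Θ j)) (xi x j) * if k = j then 1 else 0) x :=
  HasPd.comp_deriv (h.hasDerivAt_deriv_Theta ⟨x, hx, rfl⟩) (hasPd_xi k j x)

theorem contDiffOn_Theta (h : IsOrthotoric Θ D) (j : Fin m) :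
    ContDiffOn ℝ ∞ (fun y : Pt m => Θ j (xi y j)) D :=
  (h.smooth j).comp (contDiff_xi j).contDiffOn fun x hx => ⟨x, hx, rfl⟩

theorem contDiffOn_baseCoeff (h : IsOrthotoric Θ D) (j : Fin m) :
    ContDiffOn ℝ ∞ (baseCoeff Θ j) D :=
  (contDiff_Del j).contDiffOn.div (h.contDiffOn_Theta j) fun _ hx => h.Theta_ne_zero hx j

theorem contDiffOn_fibreCoeff (h : IsOrthotoric Θ D) (j : Fin m) :
    ContDiffOn ℝ ∞ (fibreCoeff Θ j) D :=
  (h.contDiffOn_Theta j).div (contDiff_Del j).contDiffOn fun _ hx => h.Del_ne_zero hx j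

theorem contDiffOn_fibreMat (h : IsOrthotoric Θ D) (a b : Fin m) :
    ContDiffOn ℝ ∞ (fun x => fibreMat Θ x a b) D := by
  simp only [fibreMat_apply]
  exact ContDiffOn.sum fun j _ => ((contDiff_sigmaHat a j).contDiffOn.mul
    (h.contDiffOn_fibreCoeff j)).mul (contDiff_sigmaHat b j).contDiffOn

theorem contDiffOn_fibreInv (h : IsOrthotoric Θ D) (a b : Fin m) :
    ContDiffOn ℝ ∞ (fun x => fibreInv Θ x a b) D := by
  simp only [fibreInv_apply]
  exact ContDiffOn.sum fun j _ => ((contDiffOn_sigmaInv h.inj a j).mul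
    (h.contDiffOn_baseCoeff j)).mul (contDiffOn_sigmaInv h.inj b j)

theorem fibreMat_mul_fibreInv (h : IsOrthotoric Θ D) {x : Pt m} (hx : x ∈ D) :
    fibreMat Θ x * fibreInv Θ x = 1 := by
  have h1 := sigmaMat_mul_sigmaInv (h.inj x hx)
  have h2 : Matrix.diagonal (fun j => fibreCoeff Θ j x) * Matrix.diagonal
      (fun j => baseCoeff Θ j x) = 1 := by
    simp [Matrix.diagonal_mul_diagonal, h.fibreCoeff_mul_baseCoeff hx]
  calc fibreMat Θ x * fibreInv Θ x = (sigmaMat x)ᵀ * (Matrix.diagonal (fun j => fibreCoeff Θ j x) *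
        ((sigmaMat x * sigmaInv x) * Matrix.diagonal (fun j => baseCoeff Θ j x))) *
          (sigmaInv x)ᵀ := by
        simp only [fibreMat, fibreInv, Matrix.mul_assoc]
    _ = 1 := by
        rw [h1, Matrix.one_mul, h2, Matrix.mul_one, ← Matrix.transpose_mul,
          sigmaInv_mul_sigmaMat (h.inj x hx), Matrix.transpose_one]

theorem fibreInv_mul_fibreMat (h : IsOrthotoric Θ D) {x : Pt m} (hx : x ∈ D) :
    fibreInv Θ x * fibreMat Θ x = 1 := mul_eq_one_comm.1 (h.fibreMat_mul_fibreInv hx)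

theorem metric_inv (h : IsOrthotoric Θ D) {x : Pt m} (hx : x ∈ D) :
    (metric Θ x)⁻¹ = Matrix.fromBlocks (Matrix.diagonal fun j => fibreCoeff Θ j x) 0 0
      (fibreInv Θ x) := by
  apply Matrix.inv_eq_right_inv
  rw [metric_eq_fromBlocks, Matrix.fromBlocks_multiply]
  simp [h.fibreMat_mul_fibreInv hx, Matrix.diagonal_mul_diagonal, h.baseCoeff_mul_fibreCoeff hx]

theorem contDiffOn_metric (h : IsOrthotoric Θ D) (i j : Fin m ⊕ Fin m) :
    ContDiffOn ℝ ∞ (fun x => metric Θ x i j) D := by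
  simp only [metric_eq_fromBlocks]
  rcases i with i | i <;> rcases j with j | j
  · by_cases hij : i = j
    · subst hij
      simpa using! h.contDiffOn_baseCoeff i
    · simpa [Matrix.diagonal_apply, hij] using contDiffOn_const
  · simpa using contDiffOn_const
  · simpa using contDiffOn_const
  · simpa using! h.contDiffOn_fibreMat i j

theorem contDiffOn_metric_inv (h : IsOrthotoric Θ D) (i j : Fin m ⊕ Fin m) :
    ContDiffOn ℝ ∞ (fun x => (metric Θ x)⁻¹ i j) D := by
  refine ContDiffOn.congr (f := fun x => Matrix.fromBlocks (Matrix.diagonal fun j =>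
    fibreCoeff Θ j x) 0 0 (fibreInv Θ x) i j) ?_ fun x hx => by rw [h.metric_inv hx]
  rcases i with i | i <;> rcases j with j | j
  · by_cases hij : i = j
    · subst hij
      simpa using! h.contDiffOn_fibreCoeff i
    · simpa [Matrix.diagonal_apply, hij] using contDiffOn_const
  · simpa using contDiffOn_const
  · simpa using contDiffOn_const
  · simpa using! h.contDiffOn_fibreInv i j

theorem contDiffOn_christoffel (h : IsOrthotoric Θ D) (k i j : Fin m ⊕ Fin m) :
    ContDiffOn ℝ ∞ (christoffel (metric Θ) k i j) D :=
  CoordGeom.contDiffOn_christoffel h.isOpen h.contDiffOn_metric h.contDiffOn_metric_inv k i j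

theorem hasPd_baseCoeff (h : IsOrthotoric Θ D) {x : Pt m} (hx : x ∈ D) (j k : Fin m) :
    HasPd (Sum.inl k) (baseCoeff Θ j) (baseCoeff Θ j x * logDerivBase Θ x j k) x := by
  have h0 := h.Theta_ne_zero hx j
  refine ((hasPd_Del (h.inj x hx) j k).mul ((h.hasPd_Theta hx j k).inv h0)).congr_val ?_
  simp only [baseCoeff, logDerivBase, logDerivTheta]
  by_cases hkj : k = j
  · simp only [hkj, if_true]
    field_simp
    ring
  · simp only [hkj, if_false]
    field_simp
    ring

theorem hasPd_fibreCoeff (h : IsOrthotoric Θ D) {x : Pt m} (hx : x ∈ D) (j k : Fin m) :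
    HasPd (Sum.inl k) (fibreCoeff Θ j) (-(fibreCoeff Θ j x * logDerivBase Θ x j k)) x := by
  have h0 := h.baseCoeff_ne_zero hx j
  rw [funext (fibreCoeff_eq_inv Θ j)]
  refine ((h.hasPd_baseCoeff hx j k).inv h0).congr_val ?_
  field_simp

theorem hasPd_fibreMat (h : IsOrthotoric Θ D) {x : Pt m} (hx : x ∈ D) (k a b : Fin m) :
    HasPd (Sum.inl k) (fun y => fibreMat Θ y a b) (fibreDer Θ k x a b) x :=
  hasPd_pd (differentiableAt_of_contDiffOn h.isOpen (h.contDiffOn_fibreMat a b) hx)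

/-- The value of `frameDer` as a bilinear form. With two columns of `sigmaMat` as arguments it is
what the product rule gives for `∂G/∂ξ_k`, which is how `fibreDer_eq` is proved. -/
theorem sum_mul_frameDer_mul (Θ : Fin m → ℝ → ℝ) (k : Fin m) (x : Pt m) (α β : Fin m → ℝ) :
    ∑ l, (∑ j, α j * frameDer Θ k x j l) * β l = ∑ j, fibreCoeff Θ j x *
      (α j * β j * (2 * (xi x k - xi x j)⁻¹ - logDerivBase Θ x j k) -
        (xi x k - xi x j)⁻¹ * (α j * β k + α k * β j)) := by
  have h1 : ∀ l, (∑ j, α j * frameDer Θ k x j l) =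
      α l * (fibreCoeff Θ l x * (2 * (xi x k - xi x l)⁻¹ - logDerivBase Θ x l k)) -
      (if l = k then ∑ j, α j * (fibreCoeff Θ j x * (xi x k - xi x j)⁻¹) else 0) -
      α k * (fibreCoeff Θ l x * (xi x k - xi x l)⁻¹) := fun l => by
    simp only [frameDer, Matrix.of_apply, mul_sub (α _), Finset.sum_sub_distrib, mul_ite, mul_zero,
      Finset.sum_ite_eq', Finset.mem_univ, if_true]
    split_ifs <;> simp
  simp only [h1, sub_mul, Finset.sum_sub_distrib, ite_mul, zero_mul, Finset.sum_ite_eq',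
    Finset.mem_univ, if_true, Finset.sum_mul]
  rw [← Finset.sum_sub_distrib, ← Finset.sum_sub_distrib]
  exact Finset.sum_congr rfl fun j _ => by ring

theorem fibreDer_eq (h : IsOrthotoric Θ D) {x : Pt m} (hx : x ∈ D) (k : Fin m) :
    fibreDer Θ k x = (sigmaMat x)ᵀ * frameDer Θ k x * sigmaMat x := by
  ext a b
  have hs := fun r j => hasPd_sigmaHat (h.inj x hx) r j k
  have h1 : HasPd (Sum.inl k) (fun y => ∑ j, sigmaHat a j y * fibreCoeff Θ j y * sigmaHat b j y) _ x
    := HasPd.sum fun j _ => ((hs a j).mul (h.hasPd_fibreCoeff hx j k)).mul (hs b j)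
  simp only [fibreDer, Matrix.of_apply, fibreMat_apply, h1.pd_eq, Matrix.mul_apply,
    Matrix.transpose_apply, sigmaMat, sum_mul_frameDer_mul]
  exact Finset.sum_congr rfl fun j _ => by ring

end IsOrthotoric

/-! ### Logarithmic derivatives of the fibre metric and the Christoffel symbols -/

/-- The logarithmic derivative `G⁻¹ ∂G/∂ξ_k` of `G = fibreMat`. -/
def fibreLog (Θ : Fin m → ℝ → ℝ) (k : Fin m) (x : Pt m) : Matrix (Fin m) (Fin m) ℝ :=
  fibreInv Θ x * fibreDer Θ k x

namespace IsOrthotoric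

/-- Up to conjugation by `sigmaMat`, `G⁻¹ ∂G` is a diagonal matrix corrected in row `k` and column
`k` only, so traces of its powers can be read off. -/
theorem fibreLog_eq (h : IsOrthotoric Θ D) {x : Pt m} (hx : x ∈ D) (k : Fin m) :
    fibreLog Θ k x = sigmaInv x * (Matrix.diagonal (fun j => baseCoeff Θ j x) * frameDer Θ k x) *
      sigmaMat x := by
  have h1 : (sigmaInv x)ᵀ * (sigmaMat x)ᵀ = 1 := by
    rw [← Matrix.transpose_mul, sigmaMat_mul_sigmaInv (h.inj x hx), Matrix.transpose_one]
  calc fibreLog Θ k x = sigmaInv x * (Matrix.diagonal (fun j => baseCoeff Θ j x) *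
        (((sigmaInv x)ᵀ * (sigmaMat x)ᵀ) * frameDer Θ k x)) * sigmaMat x := by
        simp only [fibreLog, fibreInv, h.fibreDer_eq hx, Matrix.mul_assoc]
    _ = _ := by rw [h1, Matrix.one_mul]

theorem baseCoeff_mul_frameDer (h : IsOrthotoric Θ D) {x : Pt m} (hx : x ∈ D) (k j l : Fin m) :
    (Matrix.diagonal (fun j => baseCoeff Θ j x) * frameDer Θ k x) j l =
    (if j = l then 2 * (xi x k - xi x j)⁻¹ - logDerivBase Θ x j k else 0)
    - (if l = k then (xi x k - xi x j)⁻¹ else 0)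
    - (if j = k then baseCoeff Θ k x * fibreCoeff Θ l x * (xi x k - xi x l)⁻¹ else 0) := by
  have h1 := h.baseCoeff_mul_fibreCoeff hx j
  rw [Matrix.diagonal_mul]
  simp only [frameDer, Matrix.of_apply, mul_sub (baseCoeff Θ j x), mul_ite, mul_zero, ← mul_assoc,
    h1, one_mul]
  split_ifs with h2 h3 <;> simp_all

theorem sum_logDerivBase (x : Pt m) (k : Fin m) :
    ∑ j, logDerivBase Θ x j k = 2 * sumInv x k - logDerivTheta Θ x k := by
  simp only [logDerivBase, Finset.sum_add_distrib, Finset.sum_ite_eq, Finset.mem_univ, if_true]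
  rw [← sumInv]
  ring

theorem logDerivBase_self (x : Pt m) (k : Fin m) :
    logDerivBase Θ x k k = sumInv x k - logDerivTheta Θ x k := by
  simp [logDerivBase]

/-- This is `∂_k log |det G|`: up to sign, `det(S)²` and `∏ Δ_j` are both the squared Vandermonde
determinant, so `det G = ±∏ Θ_j`. -/
theorem trace_fibreLog (h : IsOrthotoric Θ D) {x : Pt m} (hx : x ∈ D) (k : Fin m) :
    (fibreLog Θ k x).trace = logDerivTheta Θ x k := by
  rw [h.fibreLog_eq hx, Matrix.trace_mul_cycle, sigmaMat_mul_sigmaInv (h.inj x hx), Matrix.one_mul]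
  simp only [Matrix.trace, Matrix.diag_apply, h.baseCoeff_mul_frameDer hx, if_true,
    Finset.sum_sub_distrib, Finset.sum_ite_eq', Finset.mem_univ, sum_logDerivBase,
    ← Finset.mul_sum, sub_self, inv_zero, mul_zero, sumInv]
  ring

theorem trace_fibreLog_sq (h : IsOrthotoric Θ D) {x : Pt m} (hx : x ∈ D) (k : Fin m) :
    (fibreLog Θ k x * fibreLog Θ k x).trace =
      ∑ j, (2 * (xi x k - xi x j)⁻¹ - logDerivBase Θ x j k) ^ 2 +
      2 * ∑ j, baseCoeff Θ k x * fibreCoeff Θ j x * (xi x k - xi x j)⁻¹ ^ 2 := by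
  have h1 := sigmaMat_mul_sigmaInv (h.inj x hx)
  obtain ⟨M, hM⟩ : ∃ M, M = Matrix.diagonal (fun j => baseCoeff Θ j x) * frameDer Θ k x := ⟨_, rfl⟩
  have hMe : ∀ j l, M j l = _ := fun j l => (congrFun (congrFun hM j) l).trans
    (h.baseCoeff_mul_frameDer hx k j l)
  have h2 : fibreLog Θ k x * fibreLog Θ k x = sigmaInv x * (M * M) * sigmaMat x := by
    calc fibreLog Θ k x * fibreLog Θ k x
        = sigmaInv x * (M * ((sigmaMat x * sigmaInv x) * M)) * sigmaMat x := by
          simp only [h.fibreLog_eq hx, ← hM, Matrix.mul_assoc]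
      _ = _ := by rw [h1, Matrix.one_mul]
  -- The matrix is `diag(a)` minus a column `w` in position `k` minus a row `e` in position `k`. As
  -- `w k = e k = 0`, the only cross term with a trace is row times column, counted twice.
  have h3 : ∀ (a w e : Fin m → ℝ), w k = 0 → e k = 0 →
      ∑ j, ∑ l, ((if j = l then a j else 0) - (if l = k then w j else 0) -
        (if j = k then e l else 0)) * ((if l = j then a l else 0) - (if j = k then w l else 0) -
        (if l = k then e j else 0)) = ∑ j, a j ^ 2 + 2 * ∑ j, e j * w j := by
    intro a w e hw he
    simp only [mul_sub, sub_mul, Finset.sum_sub_distrib, mul_ite, ite_mul, mul_zero, zero_mul,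
      Finset.sum_ite_eq, Finset.sum_ite_eq', Finset.mem_univ, if_true, hw, he, Finset.sum_ite_irrel,
      Finset.sum_const_zero]
    simp only [pow_two, mul_comm (w _)]
    ring
  rw [h2, Matrix.trace_mul_cycle, h1, Matrix.one_mul]
  simp only [Matrix.trace, Matrix.diag_apply, Matrix.mul_apply, hMe]
  rw [h3 (fun j => 2 * (xi x k - xi x j)⁻¹ - logDerivBase Θ x j k) (fun j => (xi x k - xi x j)⁻¹)
    (fun l => baseCoeff Θ k x * fibreCoeff Θ l x * (xi x k - xi x l)⁻¹) (by simp) (by simp)]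
  simp only [pow_two, mul_assoc]

theorem pd_metric_inr (Θ : Fin m → ℝ → ℝ) (c : Fin m) (i j : Fin m ⊕ Fin m) (x : Pt m) :
    pd (Sum.inr c) (fun y => metric Θ y i j) x = 0 :=
  InvariantAlong.pd_eq_zero (fun y s => by simp only [metric_add_inr]) x

theorem pd_metric_base (h : IsOrthotoric Θ D) {x : Pt m} (hx : x ∈ D) (k i j : Fin m) :
    pd (Sum.inl k) (fun y => metric Θ y (Sum.inl i) (Sum.inl j)) x =
      if i = j then baseCoeff Θ i x * logDerivBase Θ x i k else 0 := by
  simp only [metric_eq_fromBlocks, Matrix.fromBlocks_apply₁₁, Matrix.diagonal_apply]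
  split_ifs
  · exact (h.hasPd_baseCoeff hx i k).pd_eq
  · exact (hasPd_const _ _ _).pd_eq

theorem pd_metric_mixed (Θ : Fin m → ℝ → ℝ) (k : Fin m ⊕ Fin m) (i j : Fin m) (x : Pt m) :
    pd k (fun y => metric Θ y (Sum.inl i) (Sum.inr j)) x = 0 := by
  simp only [metric_eq_fromBlocks, Matrix.fromBlocks_apply₁₂, Matrix.zero_apply]
  exact (hasPd_const _ _ _).pd_eq

theorem pd_metric_mixed' (Θ : Fin m → ℝ → ℝ) (k : Fin m ⊕ Fin m) (i j : Fin m) (x : Pt m) :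
    pd k (fun y => metric Θ y (Sum.inr i) (Sum.inl j)) x = 0 := by
  simp only [metric_eq_fromBlocks, Matrix.fromBlocks_apply₂₁, Matrix.zero_apply]
  exact (hasPd_const _ _ _).pd_eq

theorem pd_metric_fibre (Θ : Fin m → ℝ → ℝ) (k a b : Fin m) (x : Pt m) :
    pd (Sum.inl k) (fun y => metric Θ y (Sum.inr a) (Sum.inr b)) x = fibreDer Θ k x a b := by
  simp only [metric_eq_fromBlocks, Matrix.fromBlocks_apply₂₂, fibreDer, Matrix.of_apply]

section Christoffel

theorem christoffel_base (h : IsOrthotoric Θ D) {x : Pt m} (hx : x ∈ D) (k i j : Fin m) :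
    christoffel (metric Θ) (Sum.inl k) (Sum.inl i) (Sum.inl j) x =
      (1 / 2) * ((if j = k then logDerivBase Θ x k i else 0) +
        (if i = k then logDerivBase Θ x k j else 0) -
        (if i = j then fibreCoeff Θ k x * baseCoeff Θ i x * logDerivBase Θ x i k else 0)) := by
  have h1 := h.fibreCoeff_mul_baseCoeff hx k
  rw [christoffel, h.metric_inv hx, Fintype.sum_sum_type]
  simp only [Matrix.fromBlocks_apply₁₁, Matrix.fromBlocks_apply₁₂, Matrix.diagonal_apply,
    Matrix.zero_apply, zero_mul, Finset.sum_const_zero, add_zero, ite_mul,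
    Finset.sum_ite_eq, Finset.mem_univ, if_true, h.pd_metric_base hx]
  congr 1
  rw [mul_sub, mul_add, mul_ite, mul_ite, mul_ite, mul_zero, ← mul_assoc, ← mul_assoc, ← mul_assoc]
  congr 1
  congr 1
  · split_ifs with hjk
    · rw [hjk, h1, one_mul]
    · rfl
  · split_ifs with hjk
    · rw [hjk, h1, one_mul]
    · rfl

theorem christoffel_base_fibre (h : IsOrthotoric Θ D) {x : Pt m} (hx : x ∈ D) (k a b : Fin m) :
    christoffel (metric Θ) (Sum.inl k) (Sum.inr a) (Sum.inr b) x =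
      -(1 / 2) * (fibreCoeff Θ k x * fibreDer Θ k x a b) := by
  rw [christoffel, h.metric_inv hx, Fintype.sum_sum_type]
  simp only [Matrix.fromBlocks_apply₁₁, Matrix.fromBlocks_apply₁₂, Matrix.diagonal_apply,
    Matrix.zero_apply, zero_mul, Finset.sum_const_zero, add_zero, ite_mul,
    Finset.sum_ite_eq, Finset.mem_univ, if_true, pd_metric_fibre, pd_metric_mixed']
  ring

theorem christoffel_fibre_mixed (h : IsOrthotoric Θ D) {x : Pt m} (hx : x ∈ D) (a i b : Fin m) :
    christoffel (metric Θ) (Sum.inr a) (Sum.inl i) (Sum.inr b) x =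
      (1 / 2) * fibreLog Θ i x a b := by
  have hs : ∀ c, fibreDer Θ i x b c = fibreDer Θ i x c b := fun c =>
    congrFun (congrFun (fibreDer_symm Θ i x) c) b
  rw [christoffel, h.metric_inv hx, Fintype.sum_sum_type]
  simp [pd_metric_fibre, pd_metric_mixed, pd_metric_inr, fibreLog, Matrix.mul_apply, hs]

theorem christoffel_fibre_mixed' (h : IsOrthotoric Θ D) {x : Pt m} (hx : x ∈ D) (a i b : Fin m) :
    christoffel (metric Θ) (Sum.inr a) (Sum.inr b) (Sum.inl i) x =
      (1 / 2) * fibreLog Θ i x a b := by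
  have hs : ∀ c, fibreDer Θ i x b c = fibreDer Θ i x c b := fun c =>
    congrFun (congrFun (fibreDer_symm Θ i x) c) b
  rw [christoffel, h.metric_inv hx, Fintype.sum_sum_type]
  simp [pd_metric_fibre, pd_metric_mixed', pd_metric_inr, fibreLog, Matrix.mul_apply, hs]

theorem christoffel_base_mixed (h : IsOrthotoric Θ D) {x : Pt m} (hx : x ∈ D) (k i b : Fin m) :
    christoffel (metric Θ) (Sum.inl k) (Sum.inl i) (Sum.inr b) x = 0 := by
  rw [christoffel, h.metric_inv hx, Fintype.sum_sum_type]
  simp [pd_metric_mixed', pd_metric_mixed, pd_metric_inr]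

theorem christoffel_base_mixed' (h : IsOrthotoric Θ D) {x : Pt m} (hx : x ∈ D) (k i b : Fin m) :
    christoffel (metric Θ) (Sum.inl k) (Sum.inr b) (Sum.inl i) x = 0 := by
  rw [christoffel, h.metric_inv hx, Fintype.sum_sum_type]
  simp [pd_metric_mixed', pd_metric_inr]

theorem christoffel_fibre_base (h : IsOrthotoric Θ D) {x : Pt m} (hx : x ∈ D) (a i j : Fin m) :
    christoffel (metric Θ) (Sum.inr a) (Sum.inl i) (Sum.inl j) x = 0 := by
  rw [christoffel, h.metric_inv hx, Fintype.sum_sum_type]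
  simp [pd_metric_mixed, pd_metric_inr]

theorem christoffel_fibre (h : IsOrthotoric Θ D) {x : Pt m} (hx : x ∈ D) (a b c : Fin m) :
    christoffel (metric Θ) (Sum.inr a) (Sum.inr b) (Sum.inr c) x = 0 := by
  rw [christoffel, h.metric_inv hx, Fintype.sum_sum_type]
  simp [pd_metric_inr]

/-- The trace `∑ i, Γ^i_{ik}` of the Christoffel symbols. -/
def christoffelTrace : Fin m ⊕ Fin m → Pt m → ℝ
  | Sum.inl k => fun x => sumInv x k
  | Sum.inr _ => fun _ => 0

/-- The trace is `½ ∂_k log |det g|`, and `det g = ±∏ Δ_j` because the `Θ_j` of the two blocks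
cancel. Hence no `Θ_j` occurs. -/
theorem sum_christoffel (h : IsOrthotoric Θ D) (k : Fin m ⊕ Fin m) (x : Pt m) (hx : x ∈ D) :
    ∑ i, christoffel (metric Θ) i i k x = christoffelTrace k x := by
  have h1 := h.fibreCoeff_mul_baseCoeff hx
  rw [Fintype.sum_sum_type]
  rcases k with k | k
  · have h2 : ∑ a, fibreLog Θ k x a a = logDerivTheta Θ x k := h.trace_fibreLog hx k
    simp only [h.christoffel_base hx, h.christoffel_fibre_mixed' hx, if_true, ← Finset.mul_sum, h2,
      christoffelTrace, h1, one_mul, Finset.sum_sub_distrib, Finset.sum_add_distrib,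
      Finset.sum_ite_eq, Finset.sum_ite_eq', Finset.mem_univ, sum_logDerivBase]
    ring
  · simp [h.christoffel_base_mixed hx, h.christoffel_fibre hx, christoffelTrace]

end Christoffel

/-! ### Ricci curvature in the fibre directions -/

theorem fibreCoeff_mul_logDerivTheta (h : IsOrthotoric Θ D) {x : Pt m} (hx : x ∈ D) (k : Fin m) :
    fibreCoeff Θ k x * logDerivTheta Θ x k = deriv (Θ k) (xi x k) / Del k x := by
  have h0 := h.Theta_ne_zero hx k
  have h1 := h.Del_ne_zero hx k
  simp only [fibreCoeff, logDerivTheta]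
  field_simp

theorem hasPd_fibreCoeff_mul_logDerivTheta (h : IsOrthotoric Θ D) {x : Pt m} (hx : x ∈ D)
    (k : Fin m) :
    HasPd (Sum.inl k) (fun y => fibreCoeff Θ k y * logDerivTheta Θ y k)
      (deriv (deriv (Θ k)) (xi x k) / Del k x -
        sumInv x k * (fibreCoeff Θ k x * logDerivTheta Θ x k)) x := by
  have h1 := h.Del_ne_zero hx k
  refine HasPd.congr_on ?_ h.isOpen hx (u := fun y => deriv (Θ k) (xi y k) * (Del k y)⁻¹)
    fun y hy => by rw [h.fibreCoeff_mul_logDerivTheta hy, div_eq_mul_inv]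
  refine ((h.hasPd_deriv_Theta hx k k).mul ((hasPd_Del (h.inj x hx) k k).inv h1)).congr_val ?_
  rw [h.fibreCoeff_mul_logDerivTheta hx]
  simp only [if_true, sub_self, inv_zero, zero_add, mul_one]
  field_simp
  ring

/-- Differentiating `G⁻¹ G = 1` gives `∂G⁻¹ = -G⁻¹ (∂G) G⁻¹`. -/
theorem hasPd_fibreInv (h : IsOrthotoric Θ D) {x : Pt m} (hx : x ∈ D) (k a b : Fin m) :
    HasPd (Sum.inl k) (fun y => fibreInv Θ y a b)
      (-(fibreLog Θ k x * fibreInv Θ x) a b) x := by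
  have hd : ∀ a b, HasPd (Sum.inl k) (fun y => fibreInv Θ y a b) _ x := fun a b =>
    hasPd_pd (differentiableAt_of_contDiffOn h.isOpen (h.contDiffOn_fibreInv a b) hx)
  refine (hd a b).congr_val ?_
  let F : Matrix (Fin m) (Fin m) ℝ := Matrix.of fun a b => pd (Sum.inl k) (fun y => fibreInv Θ y a b) x
  have h1 : F * fibreMat Θ x + fibreInv Θ x * fibreDer Θ k x = 0 := by
    ext a b
    have h2 := HasPd.sum (s := Finset.univ) fun c _ => (hd a c).mul (h.hasPd_fibreMat hx k c b)
    have h3 : HasPd (Sum.inl k) (fun y => ∑ c, fibreInv Θ y a c * fibreMat Θ y c b) 0 x :=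
      (hasPd_const _ ((1 : Matrix (Fin m) (Fin m) ℝ) a b) x).congr_on h.isOpen hx fun y hy => by
        rw [← Matrix.mul_apply, h.fibreInv_mul_fibreMat hy]
    have h4 := h2.pd_eq.symm.trans h3.pd_eq
    rw [Finset.sum_add_distrib] at h4
    simpa [Matrix.mul_apply, F] using h4
  have h5 : F = -(fibreLog Θ k x * fibreInv Θ x) := by
    calc F = (F * fibreMat Θ x) * fibreInv Θ x := by
          rw [Matrix.mul_assoc, h.fibreMat_mul_fibreInv hx, Matrix.mul_one]
      _ = _ := by rw [eq_neg_of_add_eq_zero_left h1, Matrix.neg_mul, fibreLog]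
  exact congrFun (congrFun h5 a) b

theorem sum_mul_eq_trace (A B : Matrix (Fin m) (Fin m) ℝ) :
    ∑ a, ∑ b, A a b * B a b = (A * Bᵀ).trace := by
  simp [Matrix.trace, Matrix.mul_apply]

theorem sum_fibreInv_mul_fibreDer (h : IsOrthotoric Θ D) {x : Pt m} (hx : x ∈ D) (k : Fin m) :
    ∑ a, ∑ b, fibreInv Θ x a b * fibreDer Θ k x a b = logDerivTheta Θ x k := by
  rw [sum_mul_eq_trace, fibreDer_symm, ← h.trace_fibreLog hx, fibreLog]

/-- Second derivatives of `G` are never computed: the known function `tr(G⁻¹ · (Θ_k/Δ_k) ∂_k G) =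
Θ_k'/Δ_k` is differentiated instead, and the term coming from `∂_k G⁻¹` is moved across. -/
theorem sum_fibreInv_mul_pd (h : IsOrthotoric Θ D) {x : Pt m} (hx : x ∈ D) (k : Fin m) :
    ∑ a, ∑ b, fibreInv Θ x a b *
      pd (Sum.inl k) (fun y => fibreCoeff Θ k y * fibreDer Θ k y a b) x =
    deriv (deriv (Θ k)) (xi x k) / Del k x - sumInv x k * (fibreCoeff Θ k x * logDerivTheta Θ x k) +
      fibreCoeff Θ k x * (fibreLog Θ k x * fibreLog Θ k x).trace := by
  have hd : ∀ a b, HasPd (Sum.inl k) (fun y => fibreCoeff Θ k y * fibreDer Θ k y a b) _ x :=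
    fun a b => hasPd_pd (differentiableAt_of_contDiffOn h.isOpen ((h.contDiffOn_fibreCoeff k).mul
      (contDiffOn_pd h.isOpen (h.contDiffOn_fibreMat a b) (Sum.inl k))) hx)
  have h1 := HasPd.sum (s := Finset.univ) fun a _ => HasPd.sum (s := Finset.univ) fun b _ =>
    (h.hasPd_fibreInv hx k a b).mul (hd a b)
  have h2 : HasPd (Sum.inl k) (fun y => ∑ a, ∑ b, fibreInv Θ y a b *
      (fibreCoeff Θ k y * fibreDer Θ k y a b)) _ x :=
    (h.hasPd_fibreCoeff_mul_logDerivTheta hx k).congr_on h.isOpen hx fun y hy => by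
      rw [← h.sum_fibreInv_mul_fibreDer hy, Finset.mul_sum]
      refine Finset.sum_congr rfl fun a _ => ?_
      rw [Finset.mul_sum]
      exact Finset.sum_congr rfl fun b _ => by ring
  have h3 := h1.pd_eq.symm.trans h2.pd_eq
  have h4 : ∑ a, ∑ b, (fibreLog Θ k x * fibreInv Θ x) a b * (fibreCoeff Θ k x * fibreDer Θ k x a b)
      = fibreCoeff Θ k x * (fibreLog Θ k x * fibreLog Θ k x).trace := by
    have : (fibreLog Θ k x * fibreLog Θ k x).trace =
        ∑ a, ∑ b, (fibreLog Θ k x * fibreInv Θ x) a b * fibreDer Θ k x a b := by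
      rw [sum_mul_eq_trace, fibreDer_symm, Matrix.mul_assoc, ← fibreLog]
    rw [this, Finset.mul_sum]
    refine Finset.sum_congr rfl fun a _ => ?_
    rw [Finset.mul_sum]
    exact Finset.sum_congr rfl fun b _ => by ring
  simp only [Finset.sum_add_distrib, neg_mul, Finset.sum_neg_distrib, h4] at h3
  linarith

theorem pd_christoffel_inr (Θ : Fin m → ℝ → ℝ) (c : Fin m) (k i j : Fin m ⊕ Fin m) (x : Pt m) :
    pd (Sum.inr c) (christoffel (metric Θ) k i j) x = 0 :=
  (invariantAlong_christoffel (metric_add_inr Θ c) k i j).pd_eq_zero x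

theorem ricci_fibre (h : IsOrthotoric Θ D) {x : Pt m} (hx : x ∈ D) (a b : Fin m) :
    ricci (metric Θ) (Sum.inr a) (Sum.inr b) x =
      ∑ k, (-(1 / 2) * pd (Sum.inl k) (fun y => fibreCoeff Θ k y * fibreDer Θ k y a b) x
        - (1 / 2) * sumInv x k * fibreCoeff Θ k x * fibreDer Θ k x a b
        + (1 / 4) * fibreCoeff Θ k x * ((fibreDer Θ k x * fibreLog Θ k x) a b
          + ((fibreLog Θ k x)ᵀ * fibreDer Θ k x) a b)) := by
  have h1 : ∀ k, pd (Sum.inl k) (christoffel (metric Θ) (Sum.inl k) (Sum.inr a) (Sum.inr b)) x =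
      -(1 / 2) * pd (Sum.inl k) (fun y => fibreCoeff Θ k y * fibreDer Θ k y a b) x := fun k => by
    rw [pd_congr_on h.isOpen hx fun y hy => h.christoffel_base_fibre hy k a b]
    exact (HasPd.const_mul _ (hasPd_pd (differentiableAt_of_contDiffOn h.isOpen
      ((h.contDiffOn_fibreCoeff k).mul (contDiffOn_pd h.isOpen (h.contDiffOn_fibreMat a b)
        (Sum.inl k))) hx))).pd_eq
  rw [ricci_eq_of_trace h.isOpen hx h.contDiffOn_christoffel h.sum_christoffel]
  simp only [Fintype.sum_sum_type, pd_christoffel_inr, Finset.sum_const_zero, add_zero, h1,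
    christoffelTrace, zero_mul, h.christoffel_base_fibre hx, h.christoffel_fibre_mixed hx,
    h.christoffel_fibre_mixed' hx, h.christoffel_base_mixed' hx, h.christoffel_fibre hx,
    (hasPd_const _ (0 : ℝ) x).pd_eq, zero_add, sub_zero, mul_zero]
  rw [Finset.sum_comm (f := fun c k => 1 / 2 * fibreLog Θ k x c a * _)]
  rw [← Finset.sum_add_distrib, ← Finset.sum_add_distrib, ← Finset.sum_sub_distrib]
  refine Finset.sum_congr rfl fun k _ => ?_
  have h2 : ∑ c, -(1 / 2) * (fibreCoeff Θ k x * fibreDer Θ k x a c) * (1 / 2 * fibreLog Θ k x c b) =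
      -(1 / 4) * fibreCoeff Θ k x * (fibreDer Θ k x * fibreLog Θ k x) a b := by
    rw [Matrix.mul_apply, Finset.mul_sum]
    exact Finset.sum_congr rfl fun c _ => by ring
  have h3 : ∑ c, 1 / 2 * fibreLog Θ k x c a * (-(1 / 2) * (fibreCoeff Θ k x * fibreDer Θ k x c b)) =
      -(1 / 4) * fibreCoeff Θ k x * ((fibreLog Θ k x)ᵀ * fibreDer Θ k x) a b := by
    rw [Matrix.mul_apply, Finset.mul_sum]
    exact Finset.sum_congr rfl fun c _ => by rw [Matrix.transpose_apply]; ring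
  rw [h2, h3]
  ring

/-- On taking the `G`-trace, both the traces of `fibreLog²` and the terms with `sumInv` cancel, for
each `k` separately. -/
theorem sum_fibreInv_mul_ricci (h : IsOrthotoric Θ D) {x : Pt m} (hx : x ∈ D) :
    ∑ a, ∑ b, fibreInv Θ x a b * ricci (metric Θ) (Sum.inr a) (Sum.inr b) x =
      -(1 / 2) * ∑ k, deriv (deriv (Θ k)) (xi x k) / Del k x := by
  have h1 : ∀ k, ∑ a, ∑ b, fibreInv Θ x a b * (fibreDer Θ k x * fibreLog Θ k x) a b =
      (fibreLog Θ k x * fibreLog Θ k x).trace := fun k => by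
    have : fibreDer Θ k x * fibreLog Θ k x = (fibreDer Θ k x * fibreLog Θ k x)ᵀ := by
      simp [fibreLog, Matrix.transpose_mul, fibreDer_symm, fibreInv_symm, Matrix.mul_assoc]
    rw [sum_mul_eq_trace, ← this, ← Matrix.mul_assoc, ← fibreLog]
  have h2 : ∀ k, ∑ a, ∑ b, fibreInv Θ x a b * ((fibreLog Θ k x)ᵀ * fibreDer Θ k x) a b =
      (fibreLog Θ k x * fibreLog Θ k x).trace := fun k => by
    rw [sum_mul_eq_trace, Matrix.transpose_mul, fibreDer_symm, Matrix.transpose_transpose,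
      ← Matrix.mul_assoc, ← fibreLog]
  simp only [h.ricci_fibre hx, Finset.mul_sum]
  rw [Finset.sum_congr rfl fun a _ => Finset.sum_comm, Finset.sum_comm]
  refine Finset.sum_congr rfl fun k _ => ?_
  calc _ = -(1 / 2) * (∑ a, ∑ b, fibreInv Θ x a b *
        pd (Sum.inl k) (fun y => fibreCoeff Θ k y * fibreDer Θ k y a b) x)
      - (1 / 2) * sumInv x k * fibreCoeff Θ k x *
        (∑ a, ∑ b, fibreInv Θ x a b * fibreDer Θ k x a b)
      + (1 / 4) * fibreCoeff Θ k x *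
        ((∑ a, ∑ b, fibreInv Θ x a b * (fibreDer Θ k x * fibreLog Θ k x) a b)
        + ∑ a, ∑ b, fibreInv Θ x a b * ((fibreLog Θ k x)ᵀ * fibreDer Θ k x) a b) := by
        simp only [Finset.mul_sum, ← Finset.sum_add_distrib, ← Finset.sum_sub_distrib]
        exact Finset.sum_congr rfl fun a _ => Finset.sum_congr rfl fun b _ => by ring
    _ = _ := by
        rw [h1, h2, h.sum_fibreInv_mul_fibreDer hx, h.sum_fibreInv_mul_pd hx]
        ring

end IsOrthotoric

/-! ### Ricci curvature in the `ξ`-directions and the scalar curvature -/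

theorem hasPd_inv_xi_sub {x : Pt m} (hx : Function.Injective (xi x)) (i j : Fin m) :
    HasPd (Sum.inl i) (fun y : Pt m => (xi y i - xi y j)⁻¹) (-(xi x i - xi x j)⁻¹ ^ 2) x := by
  by_cases hij : i = j
  · subst hij
    simpa using hasPd_const (Sum.inl i) 0 x
  · have h0 : xi x i - xi x j ≠ 0 := sub_ne_zero.2 fun h => hij (hx h)
    refine (((hasPd_xi i i x).sub (hasPd_xi i j x)).inv h0).congr_val ?_
    simp [hij]

theorem hasPd_sumInv {x : Pt m} (hx : Function.Injective (xi x)) (i : Fin m) :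
    HasPd (Sum.inl i) (fun y : Pt m => sumInv y i) (-∑ j, (xi x i - xi x j)⁻¹ ^ 2) x :=
  (HasPd.sum fun j _ => hasPd_inv_xi_sub hx i j).congr_val (by simp)

namespace IsOrthotoric

theorem hasPd_logDerivTheta (h : IsOrthotoric Θ D) {x : Pt m} (hx : x ∈ D) (i : Fin m) :
    HasPd (Sum.inl i) (fun y => logDerivTheta Θ y i)
      (deriv (deriv (Θ i)) (xi x i) / Θ i (xi x i) - logDerivTheta Θ x i ^ 2) x := by
  have h0 := h.Theta_ne_zero hx i
  refine ((h.hasPd_deriv_Theta hx i i).mul ((h.hasPd_Theta hx i i).inv h0)).congr_val ?_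
  simp only [if_true, logDerivTheta]
  field_simp
  ring

/-- The Christoffel symbol `Γ^k_{ii}` of two `ξ`-directions. -/
theorem christoffel_base_diag (h : IsOrthotoric Θ D) {x : Pt m} (hx : x ∈ D) (k i : Fin m) :
    christoffel (metric Θ) (Sum.inl k) (Sum.inl i) (Sum.inl i) x =
      -(1 / 2) * (fibreCoeff Θ k x * baseCoeff Θ i x * (xi x k - xi x i)⁻¹) +
        if k = i then (1 / 2) * (sumInv x i - logDerivTheta Θ x i) else 0 := by
  rw [h.christoffel_base hx]
  by_cases hki : k = i
  · subst hki
    simp only [if_true, logDerivBase_self, h.fibreCoeff_mul_baseCoeff hx, sub_self, inv_zero]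
    ring
  · simp only [hki, Ne.symm hki, if_false, if_true, logDerivBase]
    ring

theorem pd_christoffel_base (h : IsOrthotoric Θ D) {x : Pt m} (hx : x ∈ D) (k i : Fin m) :
    pd (Sum.inl k) (christoffel (metric Θ) (Sum.inl k) (Sum.inl i) (Sum.inl i)) x =
      -(1 / 2) * (fibreCoeff Θ k x * baseCoeff Θ i x * (xi x k - xi x i)⁻¹) *
        (logDerivTheta Θ x k - sumInv x k) +
      if k = i then (1 / 2) * (-(∑ j, (xi x i - xi x j)⁻¹ ^ 2) -
        (deriv (deriv (Θ i)) (xi x i) / Θ i (xi x i) - logDerivTheta Θ x i ^ 2)) else 0 := by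
  have h1 : HasPd (Sum.inl k) (fun y => -(1 / 2) *
      (fibreCoeff Θ k y * baseCoeff Θ i y * (xi y k - xi y i)⁻¹)) (-(1 / 2) *
      (fibreCoeff Θ k x * baseCoeff Θ i x * (xi x k - xi x i)⁻¹) *
        (logDerivTheta Θ x k - sumInv x k)) x := by
    refine (HasPd.const_mul _ (((h.hasPd_fibreCoeff hx k k).mul (h.hasPd_baseCoeff hx i k)).mul
      (hasPd_inv_xi_sub (h.inj x hx) k i))).congr_val ?_
    -- For `k ≠ i`, `∂_k log(Δ_i / Θ_i) = (ξ_k - ξ_i)⁻¹` cancels the logarithmic derivative of the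
    -- factor `(ξ_k - ξ_i)⁻¹`; only the derivative of `Θ_k / Δ_k` survives.
    rw [logDerivBase_self]
    by_cases hki : k = i
    · simp [hki]
    · simp only [logDerivBase, hki, if_false]
      ring
  have h2 : HasPd (Sum.inl k) (fun y => if k = i then (1 / 2) *
      (sumInv y i - logDerivTheta Θ y i) else 0)
      (if k = i then (1 / 2) * (-(∑ j, (xi x i - xi x j)⁻¹ ^ 2) -
        (deriv (deriv (Θ i)) (xi x i) / Θ i (xi x i) - logDerivTheta Θ x i ^ 2)) else 0) x := by
    split_ifs with hki
    · subst hki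
      exact ((hasPd_sumInv (h.inj x hx) k).sub (h.hasPd_logDerivTheta hx k)).const_mul _
    · exact hasPd_const _ _ _
  exact ((h1.add h2).congr_on h.isOpen hx fun y hy => h.christoffel_base_diag hy k i).pd_eq

theorem sum_christoffel_base_mul (h : IsOrthotoric Θ D) {x : Pt m} (hx : x ∈ D) (i : Fin m) :
    ∑ k, ∑ n, christoffel (metric Θ) (Sum.inl k) (Sum.inl i) (Sum.inl n) x *
      christoffel (metric Θ) (Sum.inl n) (Sum.inl k) (Sum.inl i) x =
    (1 / 4) * (∑ k, logDerivBase Θ x k i ^ 2 + 2 * logDerivBase Θ x i i ^ 2 -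
      2 * ∑ n, fibreCoeff Θ n x * baseCoeff Θ i x * logDerivBase Θ x i n ^ 2) := by
  have h1 := h.fibreCoeff_mul_baseCoeff hx i
  simp only [h.christoffel_base hx]
  simp only [mul_sub, sub_mul, mul_add, add_mul, Finset.sum_sub_distrib, Finset.sum_add_distrib,
    mul_ite, ite_mul, mul_zero, zero_mul, Finset.sum_ite_eq, Finset.sum_ite_eq', Finset.mem_univ,
    if_true, Finset.sum_ite_irrel, Finset.sum_const_zero, h1]
  have h2 : ∑ n, 1 / 2 * (fibreCoeff Θ n x * baseCoeff Θ i x * logDerivBase Θ x i n) *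
      (1 / 2 * logDerivBase Θ x i n) =
      1 / 4 * ∑ n, fibreCoeff Θ n x * baseCoeff Θ i x * logDerivBase Θ x i n ^ 2 := by
    rw [Finset.mul_sum]
    exact Finset.sum_congr rfl fun n _ => by ring
  have h3 : ∑ n, 1 / 2 * logDerivBase Θ x i n *
      (1 / 2 * (fibreCoeff Θ n x * baseCoeff Θ i x * logDerivBase Θ x i n)) =
      1 / 4 * ∑ n, fibreCoeff Θ n x * baseCoeff Θ i x * logDerivBase Θ x i n ^ 2 := by
    rw [Finset.mul_sum]
    exact Finset.sum_congr rfl fun n _ => by ring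
  have h4 : ∑ n, 1 / 2 * logDerivBase Θ x n i * (1 / 2 * logDerivBase Θ x n i) =
      1 / 4 * ∑ n, logDerivBase Θ x n i ^ 2 := by
    rw [Finset.mul_sum]
    exact Finset.sum_congr rfl fun n _ => by ring
  rw [h2, h3, h4]
  ring

/-- The quadratic terms in the Christoffel symbols that enter `Ric(∂/∂ξ_i, ∂/∂ξ_i)`. -/
theorem sum_christoffel_mul (h : IsOrthotoric Θ D) {x : Pt m} (hx : x ∈ D) (i : Fin m) :
    ∑ k, ∑ n, christoffel (metric Θ) k (Sum.inl i) n x *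
      christoffel (metric Θ) n k (Sum.inl i) x =
    (1 / 2) * (∑ j, (xi x i - xi x j)⁻¹ ^ 2 + (sumInv x i - logDerivTheta Θ x i) ^ 2) := by
  have h1 := h.fibreCoeff_mul_baseCoeff hx i
  have hw : ∀ n, (xi x n - xi x i)⁻¹ ^ 2 = (xi x i - xi x n)⁻¹ ^ 2 := fun n => by
    rw [← neg_sub, inv_neg, neg_sq]
  -- The square has no cross term, since the extra summand sits at the index `i` where `w` vanishes.
  have hs : ∀ (f w : Fin m → ℝ) (c : ℝ), w i = 0 →
      ∑ n, f n * (w n + if n = i then c else 0) ^ 2 = ∑ n, f n * w n ^ 2 + f i * c ^ 2 := by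
    intro f w c hc
    have : ∀ n, f n * (w n + if n = i then c else 0) ^ 2 =
        f n * w n ^ 2 + if n = i then f n * c ^ 2 else 0 := fun n => by
      split_ifs with hn
      · rw [hn, hc]
        ring
      · ring
    simp [this, Finset.sum_add_distrib]
  have h2 : ∑ k, logDerivBase Θ x k i ^ 2 = ∑ j, (xi x i - xi x j)⁻¹ ^ 2 +
      (sumInv x i - logDerivTheta Θ x i) ^ 2 := by
    have := hs (fun _ => 1) (fun n => (xi x i - xi x n)⁻¹) (sumInv x i - logDerivTheta Θ x i)
      (by simp)
    simp only [one_mul] at this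
    rw [← this]
    refine Finset.sum_congr rfl fun k _ => ?_
    rw [logDerivBase]
    by_cases hk : k = i
    · simp [hk]
    · simp [hk, Ne.symm hk]
  have h3 : ∑ n, fibreCoeff Θ n x * baseCoeff Θ i x * logDerivBase Θ x i n ^ 2 =
      ∑ n, fibreCoeff Θ n x * baseCoeff Θ i x * (xi x i - xi x n)⁻¹ ^ 2 +
      (sumInv x i - logDerivTheta Θ x i) ^ 2 := by
    simp only [logDerivBase]
    rw [hs _ _ _ (by simp), h1, one_mul]
    simp only [hw]
  have h4 : ∑ j, (2 * (xi x i - xi x j)⁻¹ - logDerivBase Θ x j i) ^ 2 =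
      ∑ j, (xi x i - xi x j)⁻¹ ^ 2 + (sumInv x i - logDerivTheta Θ x i) ^ 2 := by
    rw [← h2]
    refine Finset.sum_congr rfl fun k _ => ?_
    rw [logDerivBase]
    by_cases hk : k = i
    · simp only [hk, if_true, sub_self, inv_zero]
      ring
    · simp only [Ne.symm hk, if_false]
      ring
  have h5 : ∑ a, ∑ b, (1 / 2 * fibreLog Θ i x a b) * (1 / 2 * fibreLog Θ i x b a) =
      1 / 4 * (fibreLog Θ i x * fibreLog Θ i x).trace := by
    simp only [Matrix.trace, Matrix.diag_apply, Matrix.mul_apply, Finset.mul_sum]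
    exact Finset.sum_congr rfl fun a _ => Finset.sum_congr rfl fun b _ => by ring
  simp only [Fintype.sum_sum_type, h.christoffel_base_mixed hx, h.christoffel_fibre_base hx,
    h.christoffel_fibre_mixed hx, h.christoffel_fibre_mixed' hx, zero_mul, Finset.sum_const_zero,
    add_zero, zero_add, h5, h.sum_christoffel_base_mul hx, h.trace_fibreLog_sq hx, h2, h3, h4,
    logDerivBase_self]
  -- The sums weighted by `fibreCoeff * baseCoeff` enter with opposite signs from the `ξ`-block and
  -- from the fibre block, and cancel once written alike.
  have h6 : ∑ j, baseCoeff Θ i x * fibreCoeff Θ j x * (xi x i - xi x j)⁻¹ ^ 2 =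
      ∑ n, fibreCoeff Θ n x * baseCoeff Θ i x * (xi x i - xi x n)⁻¹ ^ 2 :=
    Finset.sum_congr rfl fun n _ => by ring
  rw [h6]
  ring

/-- The factor `Θ_i / Δ_i` is the inverse metric coefficient, so these are the summands of the
scalar curvature. The sums of `(ξ_i - ξ_j)⁻²` cancel between `∂_k Γ^k_{ii}`, `∂_i sumInv` and the
quadratic terms. -/
theorem fibreCoeff_mul_ricci_base (h : IsOrthotoric Θ D) {x : Pt m} (hx : x ∈ D) (i : Fin m) :
    fibreCoeff Θ i x * ricci (metric Θ) (Sum.inl i) (Sum.inl i) x =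
      -(1 / 2) * (deriv (deriv (Θ i)) (xi x i) / Del i x) +
      (1 / 2) * (fibreCoeff Θ i x * logDerivTheta Θ x i * sumInv x i) -
      (1 / 2) * ∑ k, fibreCoeff Θ k x * logDerivTheta Θ x k * (xi x k - xi x i)⁻¹ := by
  have h1 := h.fibreCoeff_mul_baseCoeff hx i
  have h0 := h.Theta_ne_zero hx i
  have hv : pd (Sum.inl i) (fun y : Pt m => sumInv y i) x = _ :=
    (hasPd_sumInv (h.inj x hx) i).pd_eq
  have h2 : ∑ k, (fibreCoeff Θ k x * baseCoeff Θ i x * (xi x k - xi x i)⁻¹) * logDerivTheta Θ x k =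
      baseCoeff Θ i x *
        ∑ k, fibreCoeff Θ k x * logDerivTheta Θ x k * (xi x k - xi x i)⁻¹ := by
    rw [Finset.mul_sum]
    exact Finset.sum_congr rfl fun k _ => by ring
  have h3 : ∑ k, pd (Sum.inl k) (christoffel (metric Θ) (Sum.inl k) (Sum.inl i) (Sum.inl i)) x +
      ∑ k, sumInv x k * christoffel (metric Θ) (Sum.inl k) (Sum.inl i) (Sum.inl i) x =
      -(1 / 2) * (baseCoeff Θ i x *
        ∑ k, fibreCoeff Θ k x * logDerivTheta Θ x k * (xi x k - xi x i)⁻¹) +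
      (1 / 2) * (-(∑ j, (xi x i - xi x j)⁻¹ ^ 2) -
        (deriv (deriv (Θ i)) (xi x i) / Θ i (xi x i) - logDerivTheta Θ x i ^ 2)) +
      sumInv x i * ((1 / 2) * (sumInv x i - logDerivTheta Θ x i)) := by
    simp only [h.pd_christoffel_base hx, h.christoffel_base_diag hx, mul_add, Finset.sum_add_distrib,
      mul_ite, mul_zero, Finset.sum_ite_eq', Finset.mem_univ, if_true]
    rw [← h2, Finset.mul_sum]
    have h4 : ∀ f g k : Fin m → ℝ, (∀ j, f j + g j = k j) → ∀ a b c d : ℝ, a + b = c + d →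
        ∑ j, f j + a + (∑ j, g j + b) = ∑ j, k j + c + d := by
      intro f g k hf a b c d hab
      simp only [← hf, Finset.sum_add_distrib]
      linarith
    refine h4 _ _ _ (fun k => ?_) _ _ _ _ ?_ <;> ring
  rw [ricci_eq_of_trace h.isOpen hx h.contDiffOn_christoffel h.sum_christoffel,
    h.sum_christoffel_mul hx]
  simp only [Fintype.sum_sum_type, pd_christoffel_inr, Finset.sum_const_zero, add_zero,
    christoffelTrace, zero_mul, hv]
  have h5 : ∀ a b c d e : ℝ, a + b = e → fibreCoeff Θ i x * (a - c + b - d) =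
      fibreCoeff Θ i x * (e - c - d) := by
    intro a b c d e he
    rw [← he]
    ring
  rw [h5 _ _ _ _ _ h3]
  have h6 : fibreCoeff Θ i x * (deriv (deriv (Θ i)) (xi x i) / Θ i (xi x i)) =
      deriv (deriv (Θ i)) (xi x i) / Del i x := by
    rw [fibreCoeff]
    field_simp
  linear_combination (-(1 / 2) * ∑ k, fibreCoeff Θ k x * logDerivTheta Θ x k *
    (xi x k - xi x i)⁻¹) * h1 - (1 / 2) * h6

/-- The scalar curvature of an orthotoric metric is `-∑_j Θ_j''(ξ_j) / Δ_j`. -/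
theorem scalarCurvature_eq (h : IsOrthotoric Θ D) {x : Pt m} (hx : x ∈ D) :
    scalarCurvature (metric Θ) x = -∑ j, deriv (deriv (Θ j)) (xi x j) / Del j x := by
  -- After summation over `i`, exchanging the order of summation makes the last two terms of
  -- `fibreCoeff_mul_ricci_base` cancel.
  have h1 : ∑ i, ∑ k, fibreCoeff Θ k x * logDerivTheta Θ x k * (xi x k - xi x i)⁻¹ =
      ∑ i, fibreCoeff Θ i x * logDerivTheta Θ x i * sumInv x i := by
    rw [Finset.sum_comm]
    simp only [sumInv, Finset.mul_sum]
  have h2 := h.sum_fibreInv_mul_ricci hx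
  rw [scalarCurvature, h.metric_inv hx]
  simp only [Fintype.sum_sum_type, Matrix.fromBlocks_apply₁₁, Matrix.fromBlocks_apply₁₂,
    Matrix.fromBlocks_apply₂₁, Matrix.fromBlocks_apply₂₂, Matrix.diagonal_apply, Matrix.zero_apply,
    zero_mul, Finset.sum_const_zero, add_zero, zero_add, ite_mul, Finset.sum_ite_eq,
    Finset.mem_univ, if_true, h2, h.fibreCoeff_mul_ricci_base hx, Finset.sum_add_distrib,
    Finset.sum_sub_distrib, ← Finset.mul_sum, h1]
  ring

/-! ### Laplacian, gradient and the weighted scalar curvature of `σ_m` -/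

/-- The Laplacian of a function `u` of `ξ` alone. -/
theorem laplacian_eq (h : IsOrthotoric Θ D) {x : Pt m} (hx : x ∈ D) {u : Pt m → ℝ}
    (hu : ∀ a, InvariantAlong (Sum.inr a) u) :
    laplacian (metric Θ) u x = -∑ j, (Θ j (xi x j) * pd (Sum.inl j) (pd (Sum.inl j) u) x +
      deriv (Θ j) (xi x j) * pd (Sum.inl j) u x) / Del j x := by
  have h1 : ∀ a (y : Pt m), pd (Sum.inr a) u y = 0 := fun a y => (hu a).pd_eq_zero y
  have h2 : ∀ a b, pd (Sum.inr a) (pd (Sum.inr b) u) x = 0 := fun a b =>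
    ((hu a).pd (Sum.inr b)).pd_eq_zero x
  -- The `ξ`-block (`h3`) and the fibre block (`h6`) each contribute one half of the first-order
  -- term `∑ (Θ_k'/Δ_k) ∂_k u`.
  have h3 : ∑ i, fibreCoeff Θ i x * ∑ k,
      christoffel (metric Θ) (Sum.inl k) (Sum.inl i) (Sum.inl i) x * pd (Sum.inl k) u x =
      -(1 / 2) * ∑ k, fibreCoeff Θ k x * logDerivTheta Θ x k * pd (Sum.inl k) u x := by
    have h4 : ∀ k, ∑ i, fibreCoeff Θ i x *
        christoffel (metric Θ) (Sum.inl k) (Sum.inl i) (Sum.inl i) x =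
        -(1 / 2) * (fibreCoeff Θ k x * logDerivTheta Θ x k) := fun k => by
      simp only [h.christoffel_base_diag hx, mul_add, mul_ite, mul_zero, Finset.sum_add_distrib,
        Finset.sum_ite_eq, Finset.mem_univ, if_true]
      have h5 : ∑ i, fibreCoeff Θ i x * (-(1 / 2) * (fibreCoeff Θ k x * baseCoeff Θ i x *
          (xi x k - xi x i)⁻¹)) = -(1 / 2) * fibreCoeff Θ k x * sumInv x k := by
        rw [sumInv, Finset.mul_sum]
        exact Finset.sum_congr rfl fun i _ => by
          linear_combination (-(1 / 2) * fibreCoeff Θ k x * (xi x k - xi x i)⁻¹) *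
            h.fibreCoeff_mul_baseCoeff hx i
      rw [h5]
      ring
    simp only [Finset.mul_sum]
    rw [Finset.sum_comm]
    refine Finset.sum_congr rfl fun k _ => ?_
    rw [← mul_assoc, ← h4, Finset.sum_mul]
    exact Finset.sum_congr rfl fun i _ => by ring
  have h6 : ∑ a, ∑ b, fibreInv Θ x a b * ∑ k,
      christoffel (metric Θ) (Sum.inl k) (Sum.inr a) (Sum.inr b) x * pd (Sum.inl k) u x =
      -(1 / 2) * ∑ k, fibreCoeff Θ k x * logDerivTheta Θ x k * pd (Sum.inl k) u x := by
    simp only [h.christoffel_base_fibre hx, Finset.mul_sum]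
    rw [Finset.sum_congr rfl fun a _ => Finset.sum_comm, Finset.sum_comm]
    refine Finset.sum_congr rfl fun k _ => ?_
    rw [← h.sum_fibreInv_mul_fibreDer hx]
    simp only [Finset.mul_sum, Finset.sum_mul]
    exact Finset.sum_congr rfl fun a _ => Finset.sum_congr rfl fun b _ => by ring
  rw [laplacian, h.metric_inv hx]
  simp only [Fintype.sum_sum_type, Matrix.fromBlocks_apply₁₁, Matrix.fromBlocks_apply₁₂,
    Matrix.fromBlocks_apply₂₁, Matrix.fromBlocks_apply₂₂, Matrix.diagonal_apply, Matrix.zero_apply,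
    zero_mul, Finset.sum_const_zero, add_zero, zero_add, ite_mul, Finset.sum_ite_eq,
    Finset.mem_univ, if_true, h1, h2, mul_zero, h6, mul_sub, Finset.sum_sub_distrib, h3]
  have h7 : ∑ j, (Θ j (xi x j) * pd (Sum.inl j) (pd (Sum.inl j) u) x +
      deriv (Θ j) (xi x j) * pd (Sum.inl j) u x) / Del j x =
      ∑ j, fibreCoeff Θ j x * pd (Sum.inl j) (pd (Sum.inl j) u) x +
      ∑ j, fibreCoeff Θ j x * logDerivTheta Θ x j * pd (Sum.inl j) u x := by
    rw [← Finset.sum_add_distrib]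
    refine Finset.sum_congr rfl fun j _ => ?_
    rw [h.fibreCoeff_mul_logDerivTheta hx, fibreCoeff]
    ring
  rw [h7]
  ring

theorem normSqDiff_eq (h : IsOrthotoric Θ D) {x : Pt m} (hx : x ∈ D) {u : Pt m → ℝ}
    (hu : ∀ a, InvariantAlong (Sum.inr a) u) :
    normSqDiff (metric Θ) u x = ∑ j, Θ j (xi x j) * pd (Sum.inl j) u x ^ 2 / Del j x := by
  have h1 : ∀ a, pd (Sum.inr a) u x = 0 := fun a => (hu a).pd_eq_zero x
  rw [normSqDiff, h.metric_inv hx]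
  simp only [Fintype.sum_sum_type, Matrix.fromBlocks_apply₁₁, Matrix.diagonal_apply,
    zero_mul, Finset.sum_const_zero, add_zero, ite_mul, Finset.sum_ite_eq, Finset.mem_univ, if_true, h1, mul_zero, fibreCoeff]
  exact Finset.sum_congr rfl fun j _ => by ring

end IsOrthotoric

theorem sigma_top (x : Pt m) : sigma m x = ∏ j, xi x j := by
  have h : (Finset.univ : Finset (Fin m)).powersetCard m = {Finset.univ} := by
    have := Finset.powersetCard_self (Finset.univ : Finset (Fin m))
    rwa [Finset.card_fin] at this
  rw [sigma, Finset.esymm_map_val, h, Finset.sum_singleton]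

theorem sigmaHat_top (j : Fin m) (x : Pt m) :
    sigmaHat (m - 1) j x = ∏ k ∈ Finset.univ.erase j, xi x k := by
  have h : m - 1 = (Finset.univ.erase j).card := by
    rw [Finset.card_erase_of_mem (Finset.mem_univ j), Finset.card_fin]
  rw [sigmaHat, Finset.esymm_map_val, h, Finset.powersetCard_self, Finset.sum_singleton]

theorem xi_mul_sigmaHat_top (j : Fin m) (x : Pt m) : xi x j * sigmaHat (m - 1) j x = sigma m x := by
  rw [sigma_top, sigmaHat_top, Finset.mul_prod_erase _ _ (Finset.mem_univ j)]

theorem xi_ne_zero {x : Pt m} (hx : sigma m x ≠ 0) (j : Fin m) : xi x j ≠ 0 := fun h0 => by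
  rw [← xi_mul_sigmaHat_top j, h0, zero_mul] at hx
  exact hx rfl

theorem hasPd_sigma_top (j : Fin m) (x : Pt m) :
    HasPd (Sum.inl j) (sigma m) (sigmaHat (m - 1) j x) x := by
  have h := hasPd_sigma (m - 1) j x
  rwa [Nat.sub_add_cancel j.pos] at h

/-- The Euler operator `z² φ'' - 2 (p - 1) z φ' + p (p - 1) φ`, with kernel spanned by
`z ^ (p - 1)` and `z ^ p`. -/
def eulerOp (p : ℝ) (φ : ℝ → ℝ) (z : ℝ) : ℝ :=
  z ^ 2 * deriv (deriv φ) z - 2 * (p - 1) * z * deriv φ z + p * (p - 1) * φ z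

/-- The `(σ_m, p)`-scalar curvature of an orthotoric metric. -/
theorem IsOrthotoric.weightedScal_eq (h : IsOrthotoric Θ D) (p : ℝ) {x : Pt m} (hx : x ∈ D)
    (h0 : sigma m x ≠ 0) :
    weightedScal (metric Θ) (sigma m) p x =
      -sigma m x ^ 2 * ∑ j, eulerOp p (Θ j) (xi x j) / (xi x j ^ 2 * Del j x) := by
  -- As `σ_m` is affine in `ξ_j`, its pure second derivatives vanish and its first ones are `σ_m /
  -- ξ_j`.
  have h1 : ∀ j, pd (Sum.inl j) (sigma m) = (sigmaHat (m - 1) j : Pt m → ℝ) := fun j =>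
    funext fun y => (hasPd_sigma_top j y).pd_eq
  have h2 : ∀ j, pd (Sum.inl j) (sigmaHat (m - 1) j) x = 0 := fun j =>
    (hasPd_esymm_of_notMem (Finset.notMem_erase j Finset.univ) (m - 1) x).pd_eq
  have h3 : ∀ j, sigmaHat (m - 1) j x = sigma m x / xi x j := fun j => by
    rw [← xi_mul_sigmaHat_top j, mul_div_cancel_left₀ _ (xi_ne_zero h0 j)]
  rw [weightedScal, h.scalarCurvature_eq hx, h.laplacian_eq hx (invariantAlong_sigma m),
    h.normSqDiff_eq hx (invariantAlong_sigma m)]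
  simp only [h1, h2, h3, mul_neg, neg_mul, Finset.mul_sum, sub_neg_eq_add,
    ← Finset.sum_neg_distrib, ← Finset.sum_sub_distrib]
  refine Finset.sum_congr rfl fun j _ => ?_
  have h4 := xi_ne_zero h0 j
  have h5 := h.Del_ne_zero hx j
  rw [eulerOp]
  field_simp
  ring

/-! ### Killing potentials that depend on `ξ` only -/

theorem kahlerForm_base (x : Pt m) (i j : Fin m) : kahlerForm x (Sum.inl i) (Sum.inl j) = 0 := by
  simp [kahlerForm, theta]

theorem kahlerForm_fibre (x : Pt m) (i j : Fin m) : kahlerForm x (Sum.inr i) (Sum.inr j) = 0 := by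
  simp [kahlerForm, dxi]

theorem kahlerForm_base_fibre (x : Pt m) (i r : Fin m) :
    kahlerForm x (Sum.inl i) (Sum.inr r) = sigmaHat r i x := by
  simp [kahlerForm, dxi, theta]

theorem kahlerForm_fibre_base (x : Pt m) (i r : Fin m) :
    kahlerForm x (Sum.inr r) (Sum.inl i) = -sigmaHat r i x := by
  simp [kahlerForm, dxi, theta]

theorem hasPd_sum_sigma (c : ℝ) (b : Fin m → ℝ) (j : Fin m) (x : Pt m) :
    HasPd (Sum.inl j) (fun y : Pt m => c + ∑ r : Fin m, b r * sigma (r + 1) y)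
      (∑ r : Fin m, b r * sigmaHat r j x) x :=
  ((hasPd_const _ c x).add (HasPd.sum fun (r : Fin m) _ => (hasPd_sigma r j x).const_mul (b r))).congr_val
    (zero_add _)

theorem contDiff_sum_sigma (c : ℝ) (b : Fin m → ℝ) :
    ContDiff ℝ ∞ (fun y : Pt m => c + ∑ r : Fin m, b r * sigma (r + 1) y) :=
  contDiff_const.add (ContDiff.sum fun _ _ => contDiff_const.mul (contDiff_sigma _))

/-- The affine combinations of the `σ_r` are Killing potentials. -/
theorem isKillingPotential_of_eq_sum (hD : IsOpen D) {u : Pt m → ℝ} {c : ℝ} {b : Fin m → ℝ}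
    (hu : ∀ x ∈ D, u x = c + ∑ r : Fin m, b r * sigma (r + 1) x) :
    IsKillingPotential (metric Θ) kahlerForm D u := by
  -- The field is `∑ b_r ∂/∂t_r`, with constant coefficients; it is Killing because `g` does not
  -- depend on `t`.
  refine ⟨(contDiff_sum_sigma c b).contDiffOn.congr hu,
    Sum.elim (fun _ _ => 0) (fun r _ => b r), ⟨fun k => ?_, fun x _ i j => ?_⟩, fun x hx j => ?_⟩
  · rcases k with k | k <;> exact contDiffOn_const
  · have hc : ∀ (i : Fin m ⊕ Fin m) (a : ℝ), pd i (fun _ => a) x = 0 := fun i a =>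
      (hasPd_const i a x).pd_eq
    simp [Fintype.sum_sum_type, hc, IsOrthotoric.pd_metric_inr]
  · rw [pd_congr_on hD hx hu, Fintype.sum_sum_type]
    rcases j with j | j
    · simp [kahlerForm_fibre_base, (hasPd_sum_sigma c b j x).pd_eq]
    · have : InvariantAlong (Sum.inr j) (fun y : Pt m => c + ∑ r : Fin m, b r * sigma (r + 1) y) :=
        fun y s => by simp only [invariantAlong_sigma _ j y s]
      simp [kahlerForm_fibre, this.pd_eq_zero]

namespace IsOrthotoric

/-- A Killing potential that is a function of `ξ` alone is an affine combination of the `σ_r`. -/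
theorem eq_sum_of_isKillingPotential (h : IsOrthotoric Θ D) (hDc : IsPreconnected D) {u : Pt m → ℝ}
    (hinv : ∀ a, InvariantAlong (Sum.inr a) u)
    (hu : IsKillingPotential (metric Θ) kahlerForm D u) :
    ∃ (c : ℝ) (b : Fin m → ℝ), ∀ x ∈ D, u x = c + ∑ r : Fin m, b r * sigma (r + 1) x := by
  obtain ⟨husm, X, ⟨hXsm, hX⟩, hXu⟩ := hu
  -- The `dt_r`-components of `ω(X, ·) = -du` vanish, and `sigmaMat` is invertible.
  have hbase : ∀ x ∈ D, ∀ i, X (Sum.inl i) x = 0 := by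
    intro x hx i
    have h1 : (sigmaMat x)ᵀ *ᵥ (fun i => X (Sum.inl i) x) = 0 := by
      ext r
      have := hXu x hx (Sum.inr r)
      rw [(hinv r).pd_eq_zero, Fintype.sum_sum_type] at this
      simp only [kahlerForm_fibre, kahlerForm_base_fibre, mul_zero, Finset.sum_const_zero,
        add_zero, neg_zero] at this
      simpa [Matrix.mulVec, dotProduct, sigmaMat, mul_comm] using this
    have h2 : (fun i => X (Sum.inl i) x) = (sigmaInv x)ᵀ *ᵥ
        ((sigmaMat x)ᵀ *ᵥ (fun i => X (Sum.inl i) x)) := by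
      rw [Matrix.mulVec_mulVec, ← Matrix.transpose_mul, sigmaMat_mul_sigmaInv (h.inj x hx),
        Matrix.transpose_one, Matrix.one_mulVec]
    rw [h1, Matrix.mulVec_zero] at h2
    exact congrFun h2 i
  have hder : ∀ x ∈ D, ∀ j, pd (Sum.inl j) u x = ∑ r : Fin m, X (Sum.inr r) x * sigmaHat r j x := by
    intro x hx j
    have := hXu x hx (Sum.inl j)
    rw [Fintype.sum_sum_type] at this
    simp only [kahlerForm_base, kahlerForm_fibre_base, mul_zero, Finset.sum_const_zero,
      zero_add, mul_neg, Finset.sum_neg_distrib, neg_inj] at this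
    exact this.symm
  have hfib : ∀ x ∈ D, ∀ r, X (Sum.inr r) x = ∑ j, sigmaInv x r j * pd (Sum.inl j) u x := by
    intro x hx r
    have h1 : (fun j => pd (Sum.inl j) u x) = sigmaMat x *ᵥ (fun r => X (Sum.inr r) x) := by
      ext j
      simp [hder x hx, Matrix.mulVec, dotProduct, sigmaMat, mul_comm]
    have h2 : sigmaInv x *ᵥ (fun j => pd (Sum.inl j) u x) = fun r => X (Sum.inr r) x := by
      rw [h1, Matrix.mulVec_mulVec, sigmaInv_mul_sigmaMat (h.inj x hx), Matrix.one_mulVec]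
    exact (congrFun h2 r).symm
  -- With no `ξ`-components in `X`, the mixed `(ξ_i, t_s)` Killing equation reads `∑_r (∂_i X^r)
  -- G_{rs} = 0`, which kills the `ξ`-derivatives. The `t`-derivatives vanish because `hfib` gives
  -- `X^r` by a `t`-invariant formula on `D`.
  have hconst : ∀ r, ∃ c, ∀ x ∈ D, X (Sum.inr r) x = c := by
    intro r
    refine exists_const_of_pd_eq_zero h.isOpen hDc (hXsm _) fun x hx i => ?_
    rcases i with i | i
    · have h1 : (fun r => pd (Sum.inl i) (X (Sum.inr r)) x) ᵥ* fibreMat Θ x = 0 := by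
        ext s
        have hz : ∀ k l, pd l (X (Sum.inl k)) x = 0 := fun k l => by
          rw [pd_congr_on h.isOpen hx fun y hy => hbase y hy k]
          exact (hasPd_const _ _ _).pd_eq
        have := hX x hx (Sum.inl i) (Sum.inr s)
        simp only [Fintype.sum_sum_type, pd_metric_mixed, hz, mul_zero, zero_add, add_zero] at this
        simp only [metric_eq_fromBlocks, Matrix.fromBlocks_apply₂₂, Matrix.fromBlocks_apply₁₂,
          Matrix.zero_apply, zero_mul, add_zero, Finset.sum_const_zero, zero_add] at this
        simpa [Matrix.vecMul, dotProduct, mul_comm] using this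
      have h2 : (fun r => pd (Sum.inl i) (X (Sum.inr r)) x) =
          ((fun r => pd (Sum.inl i) (X (Sum.inr r)) x) ᵥ* fibreMat Θ x) ᵥ* fibreInv Θ x := by
        rw [Matrix.vecMul_vecMul, h.fibreMat_mul_fibreInv hx, Matrix.vecMul_one]
      rw [h1, Matrix.zero_vecMul] at h2
      exact congrFun h2 r
    · rw [pd_congr_on h.isOpen hx fun y hy => hfib y hy r]
      refine InvariantAlong.pd_eq_zero (fun y s => ?_) x
      simp only [sigmaInv, Matrix.of_apply, Del, xi_add_inr, (hinv i).pd _ y s]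
  choose b hb using hconst
  obtain ⟨c, hc⟩ := exists_const_of_pd_eq_zero (u := fun x => u x -
      (0 + ∑ r : Fin m, b r * sigma (r + 1) x)) h.isOpen hDc
    (husm.sub (contDiff_sum_sigma 0 b).contDiffOn) fun x hx i => by
      have hd := differentiableAt_of_contDiffOn h.isOpen husm hx
      rcases i with i | i
      · rw [((hasPd_pd hd).sub (hasPd_sum_sigma 0 b i x)).pd_eq, hder x hx]
        simp [hb _ x hx]
      · refine InvariantAlong.pd_eq_zero (fun y s => ?_) x
        simp only [hinv i y s, invariantAlong_sigma _ i y s]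
  exact ⟨c, b, fun x hx => by linarith [hc x hx]⟩

end IsOrthotoric

/-! ### The Euler equation -/

open Polynomial

section Euler

variable {I : Set ℝ} {φ φ₁ φ₂ : ℝ → ℝ} {p : ℝ}

theorem eulerOp_eq_of_hasDerivAt (hI : IsOpen I) (h₁ : ∀ z ∈ I, HasDerivAt φ (φ₁ z) z)
    (h₂ : ∀ z ∈ I, HasDerivAt φ₁ (φ₂ z) z) {z : ℝ} (hz : z ∈ I) :
    eulerOp p φ z = z ^ 2 * φ₂ z - 2 * (p - 1) * z * φ₁ z + p * (p - 1) * φ z := by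
  have h : deriv φ =ᶠ[𝓝 z] φ₁ :=
    Filter.eventually_of_mem (hI.mem_nhds hz) fun y hy => (h₁ y hy).deriv
  rw [eulerOp, h.deriv_eq, (h₂ z hz).deriv, (h₁ z hz).deriv]

/-- Writing the derivative with `z⁻¹ * |z| ^ q` gives one formula for both signs of `z`, in which
only the power `|z| ^ q` occurs. -/
theorem hasDerivAt_abs_rpow (q : ℝ) {z : ℝ} (hz : z ≠ 0) :
    HasDerivAt (fun z => |z| ^ q) (q * z⁻¹ * |z| ^ q) z := by
  have h := (hasDerivAt_abs hz).rpow_const (p := q) (Or.inl (abs_ne_zero.2 hz))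
  refine h.congr_deriv ?_
  rw [Real.rpow_sub_one (abs_ne_zero.2 hz)]
  rcases lt_or_gt_of_ne hz with h0 | h0
  · simp [abs_of_neg h0, sign_neg h0]
    ring
  · simp [abs_of_pos h0, sign_pos h0]
    ring

/-- The action of the Euler operator on polynomials. -/
def eulerPoly (p : ℝ) (P : ℝ[X]) : ℝ[X] :=
  X ^ 2 * derivative (derivative P) - C (2 * (p - 1)) * (X * derivative P) + C (p * (p - 1)) * P

/-- Monomials are eigenvectors; the eigenvalue is the indicial polynomial, with roots `p - 1` and
`p`. -/
theorem coeff_eulerPoly (p : ℝ) (P : ℝ[X]) (k : ℕ) :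
    (eulerPoly p P).coeff k = (k - p) * (k - p + 1) * P.coeff k := by
  have h1 : (X * derivative P).coeff k = k * P.coeff k := by
    rcases k with _ | k
    · simp
    · rw [coeff_X_mul, coeff_derivative]
      push_cast
      ring
  have h2 : (X ^ 2 * derivative (derivative P)).coeff k = k * (k - 1) * P.coeff k := by
    rcases k with _ | _ | k
    · simp
    · simp [pow_two, mul_assoc]
    · rw [coeff_X_pow_mul, coeff_derivative, coeff_derivative]
      push_cast
      ring
  rw [eulerPoly, coeff_add, coeff_sub, coeff_C_mul, coeff_C_mul, h1, h2]
  ring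

/-- Division coefficient by coefficient. The eigenvalue at `k ≤ n` vanishes only for `p = k` or `p =
k + 1`, hence the bound `n + 1` in the hypothesis on `p`. -/
theorem exists_eulerPoly_eq {n : ℕ} (hp : ∀ k : ℕ, k ≤ n + 1 → p ≠ k) {R : ℝ[X]}
    (hR : R.natDegree ≤ n) : ∃ P : ℝ[X], P.natDegree ≤ n ∧ eulerPoly p P = R := by
  obtain ⟨P, hc⟩ : ∃ P : ℝ[X], ∀ k : ℕ, P.coeff k =
      if k ≤ n then R.coeff k / ((k - p) * (k - p + 1)) else 0 :=
    ⟨∑ i ∈ Finset.range (n + 1), monomial i (R.coeff i / ((i - p) * (i - p + 1))), fun k => by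
      simp [coeff_monomial]⟩
  refine ⟨P, natDegree_le_iff_coeff_eq_zero.2 fun k hk => ?_, ?_⟩
  rotate_left
  · ext k
    rw [coeff_eulerPoly, hc]
    split_ifs with hk
    · have h1 : (k : ℝ) - p ≠ 0 := sub_ne_zero.2 (hp k (by omega)).symm
      have h2 : (k : ℝ) - p + 1 ≠ 0 := by
        have := hp (k + 1) (by omega)
        push_cast at this
        intro h
        exact this (by linarith)
      field_simp
    · rw [mul_zero, coeff_eq_zero_of_natDegree_lt (by omega)]
  · rw [hc, if_neg (by omega)]

theorem natDegree_eulerPoly_le {n : ℕ} {P : ℝ[X]} (hP : P.natDegree ≤ n) :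
    (eulerPoly p P).natDegree ≤ n := by
  refine natDegree_le_iff_coeff_eq_zero.2 fun k hk => ?_
  rw [coeff_eulerPoly, coeff_eq_zero_of_natDegree_lt (by omega), mul_zero]

theorem eval_eulerPoly (p : ℝ) (P : ℝ[X]) (z : ℝ) : (eulerPoly p P).eval z =
    z ^ 2 * P.derivative.derivative.eval z - 2 * (p - 1) * z * P.derivative.eval z +
      p * (p - 1) * P.eval z := by
  simp [eulerPoly]
  ring

theorem eulerOp_eq_eval (hI : IsOpen I) (h0 : (0 : ℝ) ∉ I) {P : ℝ[X]} {b₁ b₂ : ℝ}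
    (hφ : ∀ z ∈ I, φ z = P.eval z + b₁ * |z| ^ (p - 1) + b₂ * |z| ^ p) {z : ℝ} (hz : z ∈ I) :
    eulerOp p φ z = (eulerPoly p P).eval z := by
  have hne : ∀ y ∈ I, y ≠ 0 := fun y hy h => h0 (h ▸ hy)
  have hr := fun q y hy => hasDerivAt_abs_rpow q (hne y hy)
  have hr' : ∀ q, ∀ y ∈ I, HasDerivAt (fun z : ℝ => q * z⁻¹ * |z| ^ q)
      (q * (q - 1) * (y ^ 2)⁻¹ * |y| ^ q) y := fun q y hy => by
    refine (((hasDerivAt_inv (hne y hy)).const_mul q).mul (hr q y hy)).congr_deriv ?_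
    have := hne y hy
    field_simp
    ring
  rw [eulerOp_eq_of_hasDerivAt (I := I) (φ₁ := fun z => P.derivative.eval z +
      b₁ * ((p - 1) * z⁻¹ * |z| ^ (p - 1)) + b₂ * (p * z⁻¹ * |z| ^ p))
    (φ₂ := fun z => P.derivative.derivative.eval z +
      b₁ * ((p - 1) * (p - 1 - 1) * (z ^ 2)⁻¹ * |z| ^ (p - 1)) +
      b₂ * (p * (p - 1) * (z ^ 2)⁻¹ * |z| ^ p)) hI ?_ ?_ hz]
  · rw [eval_eulerPoly, hφ z hz]
    have := hne z hz
    field_simp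
    ring
  · intro y hy
    exact (((P.hasDerivAt y).add ((hr (p - 1) y hy).const_mul b₁)).add
      ((hr p y hy).const_mul b₂)).congr_of_eventuallyEq
      (Filter.eventually_of_mem (hI.mem_nhds hy) hφ)
  · intro y hy
    exact ((P.derivative.hasDerivAt y).add ((hr' (p - 1) y hy).const_mul b₁)).add
      ((hr' p y hy).const_mul b₂)

/-- The solutions of the inhomogeneous Euler equation on an interval. -/
theorem exists_eq_of_eulerOp_eq (hI : IsOpen I) (hIc : IsPreconnected I) (h0 : (0 : ℝ) ∉ I)
    (h₁ : ∀ z ∈ I, HasDerivAt φ (φ₁ z) z) (h₂ : ∀ z ∈ I, HasDerivAt φ₁ (φ₂ z) z) {P : ℝ[X]}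
    (h : ∀ z ∈ I, eulerOp p φ z = (eulerPoly p P).eval z) :
    ∃ b₁ b₂ : ℝ, ∀ z ∈ I, φ z = P.eval z + b₁ * |z| ^ (p - 1) + b₂ * |z| ^ p := by
  have hne : ∀ y ∈ I, y ≠ 0 := fun y hy h => h0 (h ▸ hy)
  have hode : ∀ z ∈ I, z ^ 2 * (φ₂ z - P.derivative.derivative.eval z) =
      2 * (p - 1) * z * (φ₁ z - P.derivative.eval z) - p * (p - 1) * (φ z - P.eval z) := by
    intro z hz
    have := h z hz
    rw [eulerOp_eq_of_hasDerivAt hI h₁ h₂ hz, eval_eulerPoly] at this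
    linarith
  have hv₁ := fun z hz => (h₁ z hz).sub (P.hasDerivAt z)
  have hv₂ := fun z hz => (h₂ z hz).sub (P.derivative.hasDerivAt z)
  have hconst : ∀ (F : ℝ → ℝ), (∀ z ∈ I, HasDerivAt F 0 z) → ∃ c, ∀ z ∈ I, F z = c :=
    fun F hF => hI.exists_is_const_of_deriv_eq_zero hIc
      (fun z hz => (hF z hz).differentiableAt.differentiableWithinAt) fun z hz => (hF z hz).deriv
  -- With `ϑ = z d/dz` the operator factors as `(ϑ - s)(ϑ - q)` for `{q, s} = {p - 1, p}`, so `(ϑ -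
  -- q)(φ - P)` is a constant times `|z|^s`.
  have hfirst : ∀ q s : ℝ, q + s = 2 * p - 1 → q * s = p * (p - 1) → ∃ c, ∀ z ∈ I,
      (z * (φ₁ z - P.derivative.eval z) - q * (φ z - P.eval z)) * |z| ^ (-s) = c := by
    intro q s hqs hqs'
    refine hconst _ fun z hz => ?_
    have hz0 := hne z hz
    refine (((((hasDerivAt_id z).mul (hv₂ z hz)).sub ((hv₁ z hz).const_mul q))).mul
      (hasDerivAt_abs_rpow (-s) hz0)).congr_deriv ?_
    have := hode z hz
    simp only [id_eq, Pi.sub_apply, Pi.mul_apply]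
    field_simp
    linear_combination |z| ^ (-s) * this -
      |z| ^ (-s) * z * (φ₁ z - P.derivative.eval z) * hqs + |z| ^ (-s) * (φ z - P.eval z) * hqs'
  obtain ⟨c₂, hc₂⟩ := hfirst (p - 1) p (by ring) (by ring)
  obtain ⟨c₁, hc₁⟩ := hfirst p (p - 1) (by ring) (by ring)
  -- Subtracting the two first integrals eliminates the derivative: `φ - P = c₂ |z|^p - c₁
  -- |z|^(p-1)`.
  refine ⟨-c₁, c₂, fun z hz => ?_⟩
  have hz0 : 0 < |z| := abs_pos.2 (hne z hz)
  have e1 : |z| ^ (-(p - 1)) * |z| ^ (p - 1) = 1 := by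
    rw [← Real.rpow_add hz0, neg_add_cancel, Real.rpow_zero]
  have e2 : |z| ^ (-p) * |z| ^ p = 1 := by
    rw [← Real.rpow_add hz0, neg_add_cancel, Real.rpow_zero]
  rw [← hc₁ z hz, ← hc₂ z hz]
  linear_combination (z * (φ₁ z - P.derivative.eval z) - p * (φ z - P.eval z)) * e1 -
    (z * (φ₁ z - P.derivative.eval z) - (p - 1) * (φ z - P.eval z)) * e2

end Euler

/-! ### Evaluation of the sum for a common polynomial -/

/-- `∑_j R(ξ_j) / (ξ_j² Δ_j)` for a polynomial `R` of degree at most `m`. -/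
theorem sum_eval_div (hm : 2 ≤ m) {x : Pt m} (hx : Function.Injective (xi x)) (h0 : sigma m x ≠ 0)
    {R : ℝ[X]} (hR : R.natDegree ≤ m) :
    sigma m x ^ 2 * ∑ j, R.eval (xi x j) / (xi x j ^ 2 * Del j x) =
      -(-1) ^ m * (R.coeff 0 * sigma (m - 1) x + R.coeff 1 * sigma m x) := by
  let N : ℝ[X] := ((Finset.univ : Finset (Fin m)).val.map (xi x) |>.map fun t => X - C t).prod
  have hcard : Multiset.card ((Finset.univ : Finset (Fin m)).val.map (xi x)) = m := by simp
  have hcoeff : ∀ k ≤ m, N.coeff k = (-1) ^ (m - k) * sigma (m - k) x := fun k hk => by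
    have := Multiset.prod_X_sub_C_coeff ((Finset.univ : Finset (Fin m)).val.map (xi x))
      (k := k) (by rw [hcard]; exact hk)
    rw [hcard] at this
    exact this
  have hdeg : N.natDegree = m := by
    rw [natDegree_multiset_prod_X_sub_C_eq_card, hcard]
  have hroot : ∀ j, N.eval (xi x j) = 0 := fun j => by
    rw [eval_multiset_prod, Multiset.prod_eq_zero_iff]
    simp only [Multiset.map_map, Multiset.mem_map]
    exact ⟨j, by simp, by simp⟩
  have hN0 : N.coeff 0 = (-1) ^ m * sigma m x := hcoeff 0 (by omega)
  have hN1 : N.coeff 1 = -(-1) ^ m * sigma (m - 1) x := by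
    rw [hcoeff 1 (by omega)]
    obtain ⟨n, rfl⟩ : ∃ n, m = n + 1 := ⟨m - 1, by omega⟩
    simp [pow_succ]
  have hNm : N.coeff m = 1 := by
    rw [hcoeff m le_rfl]
    simp [sigma, Multiset.esymm]
  have hN0' : N.coeff 0 ≠ 0 := by
    rw [hN0]
    exact mul_ne_zero (pow_ne_zero _ (by norm_num)) h0
  have heval : ∀ (Q : ℝ[X]) (z : ℝ), Q.eval z = Q.divX.eval z * z + Q.coeff 0 := fun Q z => by
    conv_lhs => rw [← divX_mul_X_add Q]
    simp
  -- `Q` has degree below `m` and agrees with `R / X²` at every `ξ_j`. Since `N(ξ_j) = 0`, the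
  -- values `1/ξ_j` and `1/ξ_j²` are those of polynomials in `N.divX` and `N.divX.divX`; they
  -- replace the two terms of `R` not divisible by `X²`.
  let Q : ℝ[X] := R.divX.divX - C (R.coeff 1 / N.coeff 0) * N.divX +
    C (R.coeff 0 / N.coeff 0) * (C (N.coeff 1 / N.coeff 0) * N.divX - N.divX.divX)
  have hQeval : ∀ j, Q.eval (xi x j) / Del j x = R.eval (xi x j) / (xi x j ^ 2 * Del j x) := by
    intro j
    have hz := xi_ne_zero h0 j
    have hd := Del_ne_zero hx j
    have e1 := heval R (xi x j)
    have e2 := heval R.divX (xi x j)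
    have e3 := heval N (xi x j)
    have e4 := heval N.divX (xi x j)
    rw [hroot] at e3
    simp only [coeff_divX, zero_add] at e2 e4
    have key : Q.eval (xi x j) * xi x j ^ 2 = R.eval (xi x j) := by
      simp only [Q, eval_add, eval_sub, eval_mul, eval_C]
      have e5 : N.divX.eval (xi x j) = -N.coeff 0 / xi x j := by
        field_simp
        linarith
      have e6 : N.divX.divX.eval (xi x j) = (-N.coeff 0 / xi x j - N.coeff 1) / xi x j := by
        rw [← e5]
        field_simp
        linarith
      rw [e5, e6, e1, e2]
      field_simp
      ring
    rw [← key]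
    field_simp
  have hQcoeff : ∀ k, m - 1 ≤ k → Q.coeff k = R.coeff (k + 2) -
      R.coeff 1 / N.coeff 0 * N.coeff (k + 1) + R.coeff 0 / N.coeff 0 *
        (N.coeff 1 / N.coeff 0 * N.coeff (k + 1) - N.coeff (k + 2)) := fun k _ => by
    simp [Q, coeff_divX, add_assoc]
  have hQdeg : Q.degree < (Finset.univ : Finset (Fin m)).card := by
    rw [Finset.card_fin, degree_lt_iff_coeff_zero]
    intro k hk
    rw [hQcoeff k (by omega), coeff_eq_zero_of_natDegree_lt (by omega),
      coeff_eq_zero_of_natDegree_lt (p := N) (n := k + 1) (by omega),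
      coeff_eq_zero_of_natDegree_lt (p := N) (n := k + 2) (by omega)]
    ring
  -- For degree below `m`, `∑ Q(ξ_j) / Δ_j` is the coefficient of `X^(m-1)` in `Q`.
  have hsum := Lagrange.coeff_eq_sum (s := Finset.univ) (v := xi x) hx.injOn hQdeg
  rw [Finset.card_fin, hQcoeff _ le_rfl, coeff_eq_zero_of_natDegree_lt (by omega),
      coeff_eq_zero_of_natDegree_lt (p := N) (n := m - 1 + 2) (by omega),
      Nat.sub_add_cancel (by omega : 1 ≤ m), hNm] at hsum
  have hsum' : ∑ j, R.eval (xi x j) / (xi x j ^ 2 * Del j x) = _ :=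
    (Finset.sum_congr rfl fun j _ => (hQeval j).symm).trans hsum.symm
  rw [hsum', hN1, hN0]
  have hs : ((-1 : ℝ) ^ m) ^ 2 = 1 := by rw [← pow_mul, mul_comm, pow_mul]; simp
  have hs' : ((-1 : ℝ) ^ m) ≠ 0 := pow_ne_zero _ (by norm_num)
  generalize (-1 : ℝ) ^ m = ε at hs hs'
  field_simp
  rw [hs]
  ring

/-! ### Separation of variables -/

section Separation

theorem xi_update (x : Pt m) (j k : Fin m) (z : ℝ) :
    xi (Function.update x (Sum.inl j) z) k = if k = j then z else xi x k := by
  simp [xi, Function.update_apply]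

theorem sigmaHat_update (x : Pt m) (j : Fin m) (z : ℝ) (r : ℕ) :
    sigmaHat r j (Function.update x (Sum.inl j) z) = sigmaHat r j x := by
  simp only [sigmaHat]
  congr 1
  refine Multiset.map_congr rfl fun k hk => ?_
  have hk' : k ∈ Finset.univ.erase j := hk
  rw [xi_update, if_neg (Finset.ne_of_mem_erase hk')]

theorem sigma_succ (x : Pt m) (j : Fin m) (r : ℕ) :
    sigma (r + 1) x = sigmaHat (r + 1) j x + xi x j * sigmaHat r j x := by
  rw [sigma]
  conv_lhs => rw [← Finset.insert_erase (Finset.mem_univ j)]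
  exact Finset.esymm_insert _ (Finset.notMem_erase j _) r

variable {W : Fin m → ℝ → ℝ} {c : ℝ} {b : Fin m → ℝ}

/-- The equation `-σ_m² ∑_j W_j(ξ_j) / (ξ_j² Δ_j) = c + ∑_r b_r σ_r`, with all the `ξ_k` but `ξ_j`
fixed, determines `W_j` as a polynomial. -/
theorem exists_polynomial_line (hm : 2 ≤ m) (hinj : ∀ x ∈ D, Function.Injective (xi x))
    (hσ : ∀ x ∈ D, sigma m x ≠ 0)
    (hW : ∀ x ∈ D, -sigma m x ^ 2 * ∑ j, W j (xi x j) / (xi x j ^ 2 * Del j x) =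
      c + ∑ r : Fin m, b r * sigma (r + 1) x) {x : Pt m} (hx : x ∈ D) (j : Fin m) :
    ∃ R : ℝ[X], R.natDegree ≤ m ∧
      (∀ z, Function.update x (Sum.inl j) z ∈ D → W j z = R.eval z) ∧
      ∀ k, k ≠ j → R.eval (xi x k) = W k (xi x k) := by
  have hvs : Set.InjOn (xi x) (Finset.univ.erase j : Finset (Fin m)) := (hinj x hx).injOn
  have hx0 := xi_ne_zero (hσ x hx)
  have hcard : (Finset.univ.erase j).card = m - 1 := by
    rw [Finset.card_erase_of_mem (Finset.mem_univ j), Finset.card_fin]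
  let e : ℝ := sigmaHat (m - 1) j x
  have he : e ≠ 0 := right_ne_zero_of_mul ((xi_mul_sigmaHat_top j x).trans_ne (hσ x hx))
  let α : ℝ := c + ∑ r : Fin m, b r * sigmaHat (r + 1) j x
  let β : ℝ := ∑ r : Fin m, b r * sigmaHat r j x
  let L : ℝ[X] := Lagrange.interpolate (Finset.univ.erase j) (xi x)
    fun k => W k (xi x k) / xi x k ^ 2
  let N : ℝ[X] := Lagrange.nodal (Finset.univ.erase j) (xi x)
  -- Along the line `ξ_j = z` one has `σ_m = z e` and `Δ_j = N(z)`, the right-hand side is `α + β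
  -- z`, and the terms with `k ≠ j` add up to `-L(z)/N(z)`. Solving for `W_j(z)` gives this
  -- polynomial. At `z = ξ_k` the factor `N` vanishes and `X² L` returns `W_k(ξ_k)`.
  refine ⟨X ^ 2 * L - (C (α / e ^ 2) + C (β / e ^ 2) * X) * N, ?_, fun z hz => ?_, fun k hk => ?_⟩
  · have hL : L.natDegree ≤ m - 2 := by
      have h1 : L.degree < ((m - 1 : ℕ) : WithBot ℕ) := by
        have := Lagrange.degree_interpolate_lt (r := fun k => W k (xi x k) / xi x k ^ 2) hvs
        rwa [hcard] at this
      refine natDegree_le_iff_coeff_eq_zero.2 fun k hk => ?_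
      exact degree_lt_iff_coeff_zero _ _ |>.1 h1 k (by omega)
    have hN : N.natDegree = m - 1 := by
      rw [Lagrange.natDegree_nodal, hcard]
    have h1 : (X ^ 2 * L).natDegree ≤ m :=
      natDegree_mul_le.trans (by rw [natDegree_X_pow]; omega)
    have h2 : (C (α / e ^ 2) + C (β / e ^ 2) * X).natDegree ≤ 1 := by
      rw [add_comm]
      exact natDegree_linear_le
    exact (natDegree_sub_le _ _).trans (max_le h1 (natDegree_mul_le.trans (by omega)))
  · have h0 := hW _ hz
    have hz0 : z ≠ 0 := by simpa [xi_update] using xi_ne_zero (hσ _ hz) j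
    have hzk : ∀ k ∈ Finset.univ.erase j, z ≠ xi x k := fun k hk h => by
      have hkj := Finset.ne_of_mem_erase hk
      refine hkj (hinj _ hz ?_)
      simp [xi_update, hkj, h]
    have hNz : N.eval z ≠ 0 := Lagrange.eval_nodal_not_at_node hzk
    have hDj : Del j (Function.update x (Sum.inl j) z) = N.eval z := by
      rw [Lagrange.eval_nodal, Del]
      refine Finset.prod_congr rfl fun k hk => ?_
      simp [xi_update, Finset.ne_of_mem_erase hk]
    have hDk : ∀ k ∈ Finset.univ.erase j, (Del k (Function.update x (Sum.inl j) z))⁻¹ =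
        -(Lagrange.nodalWeight (Finset.univ.erase j) (xi x) k * (z - xi x k)⁻¹) := by
      intro k hk
      have hkj := Finset.ne_of_mem_erase hk
      have hj : j ∈ Finset.univ.erase k := by simp [hkj.symm]
      rw [Del, ← Finset.mul_prod_erase _ _ hj, mul_inv, Lagrange.nodalWeight, ← Finset.prod_inv_distrib,
        Finset.erase_right_comm, xi_update, xi_update, if_neg hkj, if_pos rfl, ← neg_sub z, inv_neg]
      rw [neg_mul, mul_comm]
      congr 2
      refine Finset.prod_congr rfl fun l hl => ?_
      rw [xi_update, if_neg (Finset.ne_of_mem_erase (Finset.mem_of_mem_erase hl))]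
    have hrest : ∑ k ∈ Finset.univ.erase j, W k (xi (Function.update x (Sum.inl j) z) k) /
        (xi (Function.update x (Sum.inl j) z) k ^ 2 * Del k (Function.update x (Sum.inl j) z)) =
        -(L.eval z / N.eval z) := by
      rw [Lagrange.eval_interpolate_not_at_node _ hzk, mul_div_cancel_left₀ _ hNz,
        ← Finset.sum_neg_distrib]
      refine Finset.sum_congr rfl fun k hk => ?_
      rw [xi_update, if_neg (Finset.ne_of_mem_erase hk), div_mul_eq_div_mul_one_div, one_div,
        hDk k hk]
      ring
    have hright : c + ∑ r : Fin m, b r * sigma (r + 1) (Function.update x (Sum.inl j) z) =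
        α + β * z := by
      simp only [sigma_succ _ j, sigmaHat_update, xi_update, if_true, mul_add,
        Finset.sum_add_distrib, α, β, Finset.sum_mul]
      rw [add_assoc]
      congr 2
      exact Finset.sum_congr rfl fun r _ => by ring
    have hs : sigma m (Function.update x (Sum.inl j) z) = z * e := by
      rw [← xi_mul_sigmaHat_top j, sigmaHat_update, xi_update, if_pos rfl]
    rw [← Finset.add_sum_erase _ _ (Finset.mem_univ j), hrest, hright, hs, hDj, xi_update,
      if_pos rfl] at h0
    simp only [eval_sub, eval_add, eval_mul, eval_pow, eval_X, eval_C]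
    field_simp at h0 ⊢
    linear_combination -h0
  · have hk' : k ∈ Finset.univ.erase j := by simp [hk]
    have h1 : L.eval (xi x k) = W k (xi x k) / xi x k ^ 2 :=
      Lagrange.eval_interpolate_at_node _ hvs hk'
    have h2 : N.eval (xi x k) = 0 := Lagrange.eval_nodal_at_node hk'
    have h3 := hx0 k
    simp only [eval_sub, eval_mul, eval_pow, eval_X, h1, h2, mul_zero, sub_zero]
    field_simp

theorem eq_of_eval_eq_of_abs_sub_lt {P Q : ℝ[X]} {a ε : ℝ} (hε : 0 < ε)
    (h : ∀ z, |z - a| < ε → P.eval z = Q.eval z) : P = Q := by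
  refine Polynomial.eq_of_infinite_eval_eq P Q ((Set.Ioo_infinite (by linarith : a < a + ε)).mono ?_)
  intro z hz
  exact h z (by rw [abs_lt]; constructor <;> linarith [hz.1, hz.2])

theorem update_mem_ball {x y : Pt m} {ε : ℝ} (hy : y ∈ Metric.ball x ε) {i : Fin m ⊕ Fin m} {z : ℝ}
    (hz : |z - x i| < ε) : Function.update y i z ∈ Metric.ball x ε := by
  have hε : 0 < ε := (abs_nonneg _).trans_lt hz
  rw [Metric.mem_ball, dist_pi_lt_iff hε] at hy ⊢
  intro k
  by_cases hk : k = i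
  · subst hk
    simpa [Real.dist_eq] using hz
  · simpa [hk] using hy k

theorem exists_polynomial_ball (hm : 2 ≤ m) (hD : IsOpen D)
    (hinj : ∀ x ∈ D, Function.Injective (xi x)) (hσ : ∀ x ∈ D, sigma m x ≠ 0)
    (hW : ∀ x ∈ D, -sigma m x ^ 2 * ∑ j, W j (xi x j) / (xi x j ^ 2 * Del j x) =
      c + ∑ r : Fin m, b r * sigma (r + 1) x) {x : Pt m} (hx : x ∈ D) :
    ∃ R : ℝ[X], R.natDegree ≤ m ∧ ∃ ε > 0, ∀ y ∈ Metric.ball x ε, ∀ j,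
      W j (xi y j) = R.eval (xi y j) := by
  obtain ⟨ε, hε, hball⟩ := Metric.isOpen_iff.1 hD x hx
  have hxb : x ∈ Metric.ball x ε := Metric.mem_ball_self hε
  have line := fun (y : Pt m) hy j => exists_polynomial_line hm hinj hσ hW (x := y) hy j
  choose R hRdeg hRW hRk using line x hx
  have hloc : ∀ j z, |z - xi x j| < ε → W j z = (R j).eval z := fun j z hz =>
    hRW j z (hball (update_mem_ball hxb hz))
  -- Move `ξ_k` to a nearby `z`. The polynomial of the `j`-th line is unchanged, as it still
  -- represents `W_j` near `ξ_j`; but its value at the node `z` is now `W_k(z)`. So `R j` and `R k`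
  -- agree near `ξ_k`. Balls of the sup metric are boxes, so the moved points stay in `D`.
  have hR : ∀ j k, j ≠ k → R j = R k := by
    intro j k hjk
    refine eq_of_eval_eq_of_abs_sub_lt (a := xi x k) hε fun z hz => ?_
    have hx' := update_mem_ball (i := Sum.inl k) hxb hz
    obtain ⟨R', -, hR', hRk'⟩ := line _ (hball hx') j
    have h1 : R' = R j := eq_of_eval_eq_of_abs_sub_lt (a := xi x j) hε fun w hw => by
      rw [← hloc j w hw, hR' w (hball (update_mem_ball (i := Sum.inl j) hx' hw))]
    have h2 := hRk' k hjk.symm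
    rw [xi_update, if_pos rfl] at h2
    rw [← h1, h2, hloc k z hz]
  let j₀ : Fin m := ⟨0, by omega⟩
  refine ⟨R j₀, hRdeg j₀, ε, hε, fun y hy j => ?_⟩
  have h1 : R j₀ = R j := by
    by_cases h : j₀ = j
    · rw [h]
    · exact hR _ _ h
  rw [h1]
  refine hloc j _ ?_
  have := (dist_pi_lt_iff hε).1 (Metric.mem_ball.1 hy) (Sum.inl j)
  rwa [Real.dist_eq] at this

/-- Separation of variables: if `-σ_m² ∑_j W_j(ξ_j) / (ξ_j² Δ_j)` is an affine combination of the
`σ_r`, then all `W_j` are given by one polynomial of degree at most `m`. -/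
theorem exists_polynomial (hm : 2 ≤ m) (hD : IsOpen D) (hDc : IsConnected D)
    (hinj : ∀ x ∈ D, Function.Injective (xi x)) (hσ : ∀ x ∈ D, sigma m x ≠ 0)
    (hW : ∀ x ∈ D, -sigma m x ^ 2 * ∑ j, W j (xi x j) / (xi x j ^ 2 * Del j x) =
      c + ∑ r : Fin m, b r * sigma (r + 1) x) :
    ∃ R : ℝ[X], R.natDegree ≤ m ∧ ∀ x ∈ D, ∀ j, W j (xi x j) = R.eval (xi x j) := by
  have hball := fun (x : Pt m) (hx : x ∈ D) => exists_polynomial_ball hm hD hinj hσ hW hx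
  -- Coordinate lines may leave `D`, so the local polynomials must be glued: `Good x R` determines
  -- `R` and is an open condition on `x`, hence `R` does not vary over the connected set `D`.
  let Good : Pt m → ℝ[X] → Prop := fun x R => ∀ᶠ y in 𝓝 x, ∀ j, W j (xi y j) = R.eval (xi y j)
  have huniq : ∀ x R R', Good x R → Good x R' → R = R' := by
    intro x R R' h h'
    obtain ⟨ε, hε, hb⟩ := Metric.eventually_nhds_iff_ball.1 (h.and h')
    let j₀ : Fin m := ⟨0, by omega⟩
    refine eq_of_eval_eq_of_abs_sub_lt (a := xi x j₀) hε fun z hz => ?_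
    obtain ⟨h1, h2⟩ := hb _ (update_mem_ball (i := Sum.inl j₀) (Metric.mem_ball_self hε) hz)
    have h3 := (h1 j₀).symm.trans (h2 j₀)
    rwa [xi_update, if_pos rfl] at h3
  have hgood : ∀ x ∈ D, ∃ R : ℝ[X], R.natDegree ≤ m ∧ Good x R := by
    intro x hx
    obtain ⟨R, hR, ε, hε, hb⟩ := hball x hx
    exact ⟨R, hR, Metric.eventually_nhds_iff_ball.2 ⟨ε, hε, hb⟩⟩
  obtain ⟨x₀, hx₀⟩ := hDc.nonempty
  obtain ⟨R, hR, hRg⟩ := hgood x₀ hx₀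
  have hall : ∀ x ∈ D, ∀ Q, Good x₀ Q ↔ Good x Q := by
    intro x hx
    refine hDc.isPreconnected.induction₂ (fun x y => ∀ Q, Good x Q ↔ Good y Q) (fun x hx => ?_)
      (fun _ _ _ _ _ _ h1 h2 Q => (h1 Q).trans (h2 Q)) (fun _ _ _ _ h Q => (h Q).symm) hx₀ hx
    obtain ⟨R, -, hR⟩ := hgood x hx
    have hev : ∀ᶠ y in 𝓝 x, Good y R := eventually_eventually_nhds.2 hR
    refine (hev.filter_mono nhdsWithin_le_nhds).mono fun y hy Q => ⟨fun h => ?_, fun h => ?_⟩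
    · rwa [huniq x Q R h hR]
    · rwa [huniq y Q R h hy]
  exact ⟨R, hR, fun x hx => ((hall x hx R).1 hRg).self_of_nhds⟩

end Separation

/-! ### Consequences of the explicit form of `Θ_j`, and the theorem -/

/-- Rewrites combinations of `σ_{m-1}` and `σ_m` as sums `∑ b_r σ_{r+1}`; the index shift makes
their positions `m - 2` and `m - 1`, and `m ≥ 2` makes these admissible and distinct. -/
theorem exists_sum_mul_eq (hm : 2 ≤ m) (c₁ c₂ : ℝ) :
    ∃ b : Fin m → ℝ, ∀ F : ℕ → ℝ, ∑ r, b r * F r = c₁ * F (m - 2) + c₂ * F (m - 1) := by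
  refine ⟨Pi.single ⟨m - 2, by omega⟩ c₁ + Pi.single ⟨m - 1, by omega⟩ c₂, fun F => ?_⟩
  simp [Pi.single_apply, add_mul, Finset.sum_add_distrib]

/-- `c₁ σ_{m-1} + c₂ σ_m` is constant only for `c₁ = c₂ = 0`. -/
theorem eq_zero_of_sigma_const (hm : 2 ≤ m) (hD : IsOpen D) {x : Pt m} (hx : x ∈ D)
    (hinj : Function.Injective (xi x)) {c₁ c₂ c : ℝ}
    (h : ∀ y ∈ D, c₁ * sigma (m - 1) y + c₂ * sigma m y = c) : c₁ = 0 ∧ c₂ = 0 := by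
  obtain ⟨b, hb⟩ := exists_sum_mul_eq hm c₁ c₂
  have e1 : m - 2 + 1 = m - 1 := by omega
  have e2 : m - 1 + 1 = m := by omega
  have hsum : ∀ y ∈ D, c = 0 + ∑ r : Fin m, b r * sigma (r + 1) y := fun y hy => by
    rw [hb fun r => sigma (r + 1) y, e1, e2, h y hy, zero_add]
  have hz : ∀ r, b r = 0 := eq_zero_of_sum_sigmaHat hinj fun j => by
    rw [← (hasPd_sum_sigma 0 b j x).pd_eq, ← pd_congr_on hD hx hsum]
    exact (hasPd_const _ _ _).pd_eq
  -- All `b_r` are zero; testing the defining identity on indicator functions isolates `c₁` and then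
  -- `c₂`.
  have h1 := hb fun r => if r = m - 2 then 1 else 0
  have h2 := hb fun r => if r = m - 1 then 1 else 0
  simp only [hz, zero_mul, Finset.sum_const_zero, if_true] at h1 h2
  rw [if_neg (by omega)] at h1 h2
  constructor <;> linarith

/-- The powers `|z|^(p-1)` and `|z|^p` are annihilated by the Euler operator, so `sum_eval_div`
applies to `eulerPoly p P`. The constants are its eigenvalues at `k = 0` and `k = 1`. -/
theorem IsOrthotoric.weightedScal_of_hasForm (h : IsOrthotoric Θ D) (hm : 2 ≤ m)
    (hσ : ∀ x ∈ D, sigma m x ≠ 0) {p : ℝ} {P : ℝ[X]} {b₁ b₂ : Fin m → ℝ} (hP : P.natDegree ≤ m)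
    (hform : HasForm Θ D p P b₁ b₂) {x : Pt m} (hx : x ∈ D) :
    weightedScal (metric Θ) (sigma m) p x =
      (-1) ^ m * (p * (p - 1) * P.coeff 0) * sigma (m - 1) x +
      (-1) ^ m * ((p - 1) * (p - 2) * P.coeff 1) * sigma m x := by
  have h1 : ∀ j, eulerOp p (Θ j) (xi x j) = (eulerPoly p P).eval (xi x j) := fun j =>
    eulerOp_eq_eval (h.isOpen_image j) (fun ⟨y, hy, hy0⟩ => xi_ne_zero (hσ y hy) j hy0) (hform j)
      ⟨x, hx, rfl⟩
  have h2 := sum_eval_div hm (h.inj x hx) (hσ x hx) (natDegree_eulerPoly_le (p := p) hP)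
  rw [h.weightedScal_eq p hx (hσ x hx)]
  simp only [h1, neg_mul, h2, coeff_eulerPoly]
  push_cast
  ring

end Orthotoric

end

theorem propositionA2 (m : ℕ) (hm : 2 ≤ m) (p : ℝ) (hp : ∀ k : ℕ, k ≤ m + 1 → p ≠ k)
    (D : Set (Pt m)) (hDo : IsOpen D) (hDc : IsConnected D)
    (Θ : Fin m → ℝ → ℝ)
    (hΘ : ∀ j, ContDiffOn ℝ ∞ (Θ j) ((fun x : Pt m => xi x j) '' D))
    (hinj : ∀ x ∈ D, Function.Injective (xi x))
    (hpos : ∀ x ∈ D, ∀ j, 0 < Θ j (xi x j) / Del j x)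
    (hσ : ∀ x ∈ D, sigma m x ≠ 0) :
    (IsWeightedExtremal (metric Θ) kahlerForm D (sigma m) p ↔
      ∃ P : Polynomial ℝ, P.natDegree ≤ m ∧ ∃ b₁ b₂ : Fin m → ℝ, HasForm Θ D p P b₁ b₂) ∧
    ∀ (P : Polynomial ℝ) (b₁ b₂ : Fin m → ℝ), P.natDegree ≤ m → HasForm Θ D p P b₁ b₂ →
      (∃ c₁ c₂ : ℝ, ∀ x ∈ D,
        weightedScal (metric Θ) (sigma m) p x = c₁ * sigma (m - 1) x + c₂ * sigma m x) ∧
      ((∃ c : ℝ, ∀ x ∈ D, weightedScal (metric Θ) (sigma m) p x = c) ↔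
        ∀ x ∈ D, weightedScal (metric Θ) (sigma m) p x = 0) ∧
      ((∀ x ∈ D, weightedScal (metric Θ) (sigma m) p x = 0) ↔
        P.eval 0 = 0 ∧ P.derivative.eval 0 = 0) := by
  have h : IsOrthotoric Θ D := ⟨hDo, hΘ, hinj, hpos⟩
  obtain ⟨x₀, hx₀⟩ := hDc.nonempty
  have e1 : m - 2 + 1 = m - 1 := by omega
  have e2 : m - 1 + 1 = m := by omega
  refine ⟨⟨fun hext => ?_, ?_⟩, fun P b₁ b₂ hP hform => ?_⟩
  · obtain ⟨c, b, hcb⟩ := h.eq_sum_of_isKillingPotential hDc.isPreconnected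
      (fun a => invariantAlong_weightedScal (metric_add_inr Θ a) (invariantAlong_sigma m a) p) hext.2
    obtain ⟨R, hR, hRΘ⟩ := exists_polynomial (W := fun j => eulerOp p (Θ j)) hm hDo hDc hinj hσ
      fun x hx => by rw [← h.weightedScal_eq p hx (hσ x hx), hcb x hx]
    -- `P` is a particular solution common to all `j`; only the homogeneous part of `Θ_j` depends on
    -- `j`.
    obtain ⟨P, hP, rfl⟩ := exists_eulerPoly_eq hp hR
    have hsol : ∀ j, ∃ b₁ b₂ : ℝ, ∀ z ∈ (fun x : Pt m => xi x j) '' D,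
        Θ j z = P.eval z + b₁ * |z| ^ (p - 1) + b₂ * |z| ^ p := fun j =>
      exists_eq_of_eulerOp_eq (h.isOpen_image j)
        (hDc.isPreconnected.image _ (contDiff_xi j).continuous.continuousOn)
        (fun ⟨y, hy, hy0⟩ => xi_ne_zero (hσ y hy) j hy0) (fun z hz => h.hasDerivAt_Theta hz)
        (fun z hz => h.hasDerivAt_deriv_Theta hz) fun z ⟨y, hy, hyz⟩ => hyz ▸ hRΘ y hy j
    choose b₁ b₂ hb using hsol
    exact ⟨P, hP, b₁, b₂, hb⟩
  · rintro ⟨P, hP, b₁, b₂, hform⟩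
    have hkill : ∀ (u : Pt m → ℝ) (c₁ c₂ : ℝ),
        (∀ x ∈ D, u x = c₁ * sigma (m - 1) x + c₂ * sigma m x) →
        IsKillingPotential (metric Θ) kahlerForm D u := fun u c₁ c₂ hu => by
      obtain ⟨b, hb⟩ := exists_sum_mul_eq hm c₁ c₂
      refine isKillingPotential_of_eq_sum hDo (c := 0) (b := b) fun x hx => ?_
      rw [hb fun r => sigma (r + 1) x, e1, e2, hu x hx, zero_add]
    exact ⟨hkill _ 0 1 fun x _ => by ring,
      hkill _ _ _ fun x hx => h.weightedScal_of_hasForm hm hσ hP hform hx⟩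
  · have hS := fun x hx => h.weightedScal_of_hasForm hm hσ hP hform (x := x) hx
    -- These three exclusions make the coefficients `p(p-1)` and `(p-1)(p-2)` nonzero.
    have hp0 : p ≠ 0 := by simpa using hp 0 (by omega)
    have hp1 : p - 1 ≠ 0 := sub_ne_zero.2 (by simpa using hp 1 (by omega))
    have hp2 : p - 2 ≠ 0 := sub_ne_zero.2 (by simpa using hp 2 (by omega))
    have hconst : ∀ c : ℝ, (∀ x ∈ D, weightedScal (metric Θ) (sigma m) p x = c) →
        P.coeff 0 = 0 ∧ P.coeff 1 = 0 := fun c hc => by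
      obtain ⟨h1, h2⟩ := eq_zero_of_sigma_const hm hDo hx₀ (hinj x₀ hx₀)
        fun x hx => (hS x hx).symm.trans (hc x hx)
      have hs : (-1 : ℝ) ^ m ≠ 0 := pow_ne_zero _ (by norm_num)
      simp only [mul_eq_zero, hs, hp0, hp1, hp2, false_or] at h1 h2
      exact ⟨h1, h2⟩
    have hzero : P.coeff 0 = 0 ∧ P.coeff 1 = 0 →
        ∀ x ∈ D, weightedScal (metric Θ) (sigma m) p x = 0 := fun ⟨h0, h1⟩ x hx => by
      rw [hS x hx, h0, h1]
      ring
    have hd : P.derivative.eval 0 = P.coeff 1 := by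
      rw [← Polynomial.coeff_zero_eq_eval_zero, Polynomial.coeff_derivative]
      simp
    refine ⟨⟨_, _, hS⟩, ⟨fun ⟨c, hc⟩ => hzero (hconst c hc), fun h0 => ⟨0, h0⟩⟩, ?_⟩
    rw [hd, ← Polynomial.coeff_zero_eq_eval_zero]
    exact ⟨hconst 0, hzero⟩
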